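/- Theorem. Let $M$ be a compact (Hausdorff) topological manifold with boundary, of dimension $d\ge 1$, whose boundary $\partial M$ is non-empty, and suppose that no connected component of $M$ is homeomorphic to the closed interval $[0,1]$. Let $\mathrm{Homeo}_0(M,\partial M)$ be the connected component of the identity in the topological group (with the $C^0$, i.e. compact-open, topology) of all homeomorphisms of $M$ that fix every point of $\partial M$, and let $n\ge 0$ be an integer. Then: 1. The set of $n$-tuples $(f_1,\dots,f_n)\in \mathrm{Homeo}_0(M,\partial M)^n$ for which the subgroup $\langle f_1,\dots,f_n\rangle$ is discrete (i.e. its subspace topology is the discrete one) contains an open dense subset of $\mathrm{Homeo}_0(M,\partial M)^n$. 2. Consequently, the set $\Omega_n$ of $n$-tuples $(f_1,\dots,f_n)\in \mathrm{Homeo}_0(M,\partial M)^n$ for which $\langle f_1,\dots,f_n\rangle$ is dense in $\mathrm{Homeo}_0(M,\partial M)$ is contained in a closed nowhere dense subset of $\mathrm{Homeo}_0(M,\partial M)^n$. -/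

import Mathlib

open Set Topology

namespace ManifoldHomeo

/-- The compact-open topology on the homeomorphism group of `M`, induced from `C(M, M)`. For a
compact metrizable `M` this is the topology of the uniform (`C⁰`) metric. -/
instance homeoTopology (M : Type*) [TopologicalSpace M] : TopologicalSpace (M ≃ₜ M) :=
  TopologicalSpace.induced (fun f : M ≃ₜ M => (f : C(M, M))) inferInstance

theorem continuous_toContinuousMap (M : Type*) [TopologicalSpace M] :
    Continuous (fun f : M ≃ₜ M => (f : C(M, M))) :=
  continuous_induced_dom

/-- The homeomorphism group of a compact Hausdorff space is a topological group. -/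
instance homeo_isTopologicalGroup (M : Type*) [TopologicalSpace M] [T2Space M] [CompactSpace M] :
    IsTopologicalGroup (M ≃ₜ M) where
  continuous_mul := by
    refine continuous_induced_rng.2 ?_
    exact ((continuous_toContinuousMap M).comp continuous_fst).compCM
      ((continuous_toContinuousMap M).comp continuous_snd)
  continuous_inv := by
    refine continuous_induced_rng.2 ?_
    refine ContinuousMap.continuous_compactOpen.2 fun K hK U hU => ?_
    have h : {f : M ≃ₜ M | MapsTo (f : C(M, M)) Uᶜ Kᶜ} =
        {f : M ≃ₜ M | MapsTo ((f⁻¹ : M ≃ₜ M) : C(M, M)) K U} := by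
      ext f
      constructor
      · intro hf x hx
        by_contra hxU
        exact hf hxU (show f (f.symm x) ∈ K by simpa using hx)
      · intro hf x hx hfx
        exact hx (show x ∈ U by simpa using show f.symm (f x) ∈ U from hf hfx)
    refine h ▸ ?_
    exact (ContinuousMap.isOpen_setOfPred_mapsTo hU.isClosed_compl.isCompact
      hK.isClosed.isOpen_compl).preimage (continuous_toContinuousMap M)

/-- The interior of a topological `d`-manifold with boundary `M`: the points that have an open
neighbourhood homeomorphic to an open subset of `ℝᵈ`. -/
def manifoldInterior (d : ℕ) (M : Type*) [TopologicalSpace M] : Set M :=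
  {x | ∃ e : OpenPartialHomeomorph M (EuclideanSpace ℝ (Fin d)), x ∈ e.source}

/-- The boundary `∂M` of a topological `d`-manifold with boundary `M`: the points that have no open
neighbourhood homeomorphic to an open subset of `ℝᵈ`. (No smooth structure is present, so this
chart-independent definition is used instead of one that reads the boundary off preferred charts;
by invariance of domain the two agree.) -/
def manifoldBoundary (d : ℕ) (M : Type*) [TopologicalSpace M] : Set M :=
  (manifoldInterior d M)ᶜ

/-- The group of homeomorphisms of `M` that fix every point of `∂M`. -/
def homeoFixingBoundary (d : ℕ) (M : Type*) [TopologicalSpace M] : Subgroup (M ≃ₜ M) where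
  carrier := {f | ∀ x ∈ manifoldBoundary d M, f x = x}
  one_mem' := fun _ _ => rfl
  mul_mem' := by
    intro f g hf hg x hx
    change f (g x) = x
    rw [hg x hx, hf x hx]
  inv_mem' := by
    intro f hf x hx
    change f.symm x = x
    rw [Homeomorph.symm_apply_eq, hf x hx]

/-- `Homeo₀(M, ∂M)`: the connected component of the identity in the topological group of
homeomorphisms of `M` that fix every point of `∂M`. -/
abbrev Homeo₀ (d : ℕ) (M : Type*) [TopologicalSpace M] [T2Space M] [CompactSpace M] : Type _ :=
  Subgroup.connectedComponentOfOne (homeoFixingBoundary d M)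

/-- The set of `n`-tuples in a topological group `G` that generate a discrete subgroup. -/
def discreteTuples (n : ℕ) (G : Type*) [Group G] [TopologicalSpace G] : Set (Fin n → G) :=
  {f | DiscreteTopology (Subgroup.closure (range f))}

/-- The set `Ωₙ` of `n`-tuples in a topological group `G` that generate a dense subgroup. -/
def topologicallyGeneratingTuples (n : ℕ) (G : Type*) [Group G] [TopologicalSpace G] :
    Set (Fin n → G) :=
  {f | Dense (Subgroup.closure (range f) : Set G)}

end ManifoldHomeo

/-! The dimension is at least 2, because the component of a boundary point of a compact 1-manifold
is a closed interval. The engine is then ping-pong near a boundary point `b`, which every element of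
the group fixes.

Given a tuple `g` and a neighbourhood of it, choose a small open copy of `ℝᵈ` near `b` whose closure
contains a neighbourhood of `b`. As each `g i` fixes `b`, some open part of this piece is sent back
into the piece by every `g i` (`exists_isOpen_forall_smul_mem`). Place there 2n + 1 disjoint balls:
one for each letter `f i`, `(f i)⁻¹`, and one for a base point. When d ≥ 2, homeomorphisms supported
in the piece move finite sets of points at will and squeeze balls. So each `g i` can be replaced by
`h i * g i * k i`, which sends every ball except that of `(f i)⁻¹` into the ball of `f i`, and whose
inverse does the opposite (`exists_squeeze`). Homeomorphisms supported near `b` are close to the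
identity, so the new tuple is close to `g`. Hence ping-pong tuples are dense; they form an open set
because the conditions send compact sets into open ones.

A non-trivial reduced word in a ping-pong tuple takes the base point into a letter ball. The
elements that keep it out of these balls thus form a neighbourhood of 1 meeting the generated
subgroup only in 1: the subgroup is discrete. If it were also dense, `{1}` would be clopen in a
connected non-trivial group, which is impossible.

In dimension one, consider all arcs issuing from `b`. They are nested, and their union is not
closed. A limit point outside the union cannot be interior, since an arc would extend through it; so
it is an end point, and the arc that reaches it is a whole component. -/

namespace ManifoldHomeo

/-! ### Reduced words and the ping-pong lemma. -/

section PingPong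

variable {ι G X : Type*} [Group G] [MulAction G X]

/-- `ReducedFrom φ w s`: either `w = 1` and `s = none`, or `w` is the product of a non-empty reduced
word in the letters `φ (i, true) = (φ (i, false))⁻¹`, whose first letter is `s`. -/
inductive ReducedFrom (φ : ι × Bool → G) : G → Option (ι × Bool) → Prop
  | one : ReducedFrom φ 1 none
  | mul (w : G) (s : Option (ι × Bool)) (i : ι) (c : Bool) (h : ReducedFrom φ w s)
      (hs : s ≠ some (i, !c)) : ReducedFrom φ (φ (i, c) * w) (some (i, c))

/-- If the word starts with the inverse letter, the two cancel and the tail is already reduced;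
otherwise the longer word is reduced. -/
theorem ReducedFrom.exists_mul {φ : ι × Bool → G} (hφ : ∀ i, φ (i, false) = (φ (i, true))⁻¹)
    {w : G} {s : Option (ι × Bool)} (h : ReducedFrom φ w s) (i : ι) (c : Bool) :
    ∃ t, ReducedFrom φ (φ (i, c) * w) t := by
  by_cases hs : s = some (i, !c)
  · subst hs
    cases h with
    | mul w s _ _ h hs =>
      refine ⟨s, ?_⟩
      have : φ (i, c) * (φ (i, !c) * w) = w := by
        cases c <;> simp [hφ]
      rwa [this]
  · exact ⟨_, .mul w s i c h hs⟩

theorem exists_reducedFrom (f : ι → G) {w : G} (hw : w ∈ Subgroup.closure (range f)) :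
    ∃ s, ReducedFrom (fun l : ι × Bool => if l.2 then f l.1 else (f l.1)⁻¹) w s := by
  induction hw using Subgroup.closure_induction_left with
  | one => exact ⟨none, .one⟩
  | mul_left x hx y hy ih =>
    obtain ⟨i, rfl⟩ := hx
    obtain ⟨s, hs⟩ := ih
    simpa using hs.exists_mul (by simp) i true
  | inv_mul_cancel x hx y hy ih =>
    obtain ⟨i, rfl⟩ := hx
    obtain ⟨s, hs⟩ := ih
    simpa using hs.exists_mul (by simp) i false

theorem ReducedFrom.smul_mem {φ : ι × Bool → G} {A : Option (ι × Bool) → Set X}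
    (hA : ∀ i c s, s ≠ some (i, !c) → ∀ x ∈ A s, φ (i, c) • x ∈ A (some (i, c)))
    {x : X} (hx : x ∈ A none) {w : G} {s : Option (ι × Bool)} (h : ReducedFrom φ w s) :
    w • x ∈ A s := by
  induction h with
  | one => simpa using hx
  | mul w s i c _ hs ih => rw [mul_smul]; exact hA i c s hs _ ih

theorem ReducedFrom.eq_one {φ : ι × Bool → G} {w : G} (h : ReducedFrom φ w none) : w = 1 := by
  cases h; rfl

/-- The ping-pong lemma for a family of sets that need not cover the space. -/
theorem eq_one_of_pingPong (f : ι → G) (A : Option (ι × Bool) → Set X)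
    (hpos : ∀ i s, s ≠ some (i, false) → ∀ x ∈ A s, f i • x ∈ A (some (i, true)))
    (hneg : ∀ i s, s ≠ some (i, true) → ∀ x ∈ A s, (f i)⁻¹ • x ∈ A (some (i, false)))
    {x : X} (hx : x ∈ A none) {w : G} (hw : w ∈ Subgroup.closure (range f))
    (hwx : ∀ l, w • x ∉ A (some l)) : w = 1 := by
  obtain ⟨s, hs⟩ := exists_reducedFrom f hw
  have := hs.smul_mem (A := A) (X := X) (fun i c s hs y hy => by
    cases c
    · simpa using hneg i s (by simpa using hs) y hy
    · simpa using hpos i s (by simpa using hs) y hy) hx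
  rcases s with _ | l
  · exact hs.eq_one
  · exact absurd this (hwx l)

end PingPong

/-! ### Homeomorphisms supported in a Euclidean piece. -/

section Supported

variable {M : Type*} [TopologicalSpace M] [T2Space M]

/-- Homeomorphisms supported in small neighbourhoods of a point are close to the identity. -/
theorem exists_nhds_forall_eqOn_compl_mem (b : M) {V : Set (M ≃ₜ M)} (hV : V ∈ 𝓝 1) :
    ∃ N ∈ 𝓝 b, ∀ f : M ≃ₜ M, (∀ x ∉ N, f x = x) → f ∈ V := by
  -- This is the filter of homeomorphisms whose set of moved points shrinks to `b`. Stating the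
  -- claim as convergence along it reduces the proof to one pair `K ⊆ U`.
  let l : Filter (M ≃ₜ M) := Filter.comap (fun f => {x | f x ≠ x}) (𝓝 b).smallSets
  have key : Filter.Tendsto id l (𝓝 (1 : M ≃ₜ M)) := by
    rw [nhds_induced, Filter.tendsto_comap_iff, ContinuousMap.tendsto_nhds_compactOpen]
    intro K hK U hU hKU
    have hKU' : K ⊆ U := fun x hx => hKU hx
    obtain ⟨N, hN, hNU⟩ : ∃ N ∈ 𝓝 b, ∀ f : M ≃ₜ M, (∀ x ∉ N, f x = x) → MapsTo f K U := by
      by_cases hb : b ∈ U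
      -- A point sent outside `U` would have a fixed image, so by injectivity it would itself be
      -- fixed, although it lies in `U`.
      · refine ⟨U, hU.mem_nhds hb, fun f hf x hx => ?_⟩
        by_contra hxU
        have : f (f x) = f x := hf _ hxU
        exact hxU (by rw [f.injective this]; exact hKU' hx)
      · refine ⟨Kᶜ, hK.isClosed.isOpen_compl.mem_nhds fun h => hb (hKU' h), fun f hf x hx => ?_⟩
        rw [hf x fun h => h hx]
        exact hKU' hx
    have hN' : ∀ᶠ t in (𝓝 b).smallSets, t ⊆ N :=
      Filter.eventually_smallSets.2 ⟨N, hN, fun t ht => ht⟩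
    refine Filter.eventually_comap.2 ?_
    filter_upwards [hN'] with t ht f hft
    exact hNU f fun x hx => by
      by_contra h
      exact hx (ht (hft ▸ h))
  obtain ⟨t, ht, htV⟩ := Filter.mem_comap.1 (key hV)
  obtain ⟨N, hN, hNt⟩ := Filter.eventually_smallSets.1 (show ∀ᶠ s in (𝓝 b).smallSets, s ∈ t from ht)
  exact ⟨N, hN, fun f hf => htV (hNt _ fun x hx => by by_contra h; exact hx (hf x h))⟩

end Supported

theorem range_subset_manifoldInterior {d : ℕ} {M : Type*} [TopologicalSpace M]
    {e : EuclideanSpace ℝ (Fin d) → M} (he : IsOpenEmbedding e) :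
    range e ⊆ manifoldInterior d M := by
  rintro _ ⟨x, rfl⟩
  exact ⟨(he.toOpenPartialHomeomorph e).symm, by simp⟩

/-- A family of maps of `E`, conjugated by `e : E → M` and extended by the identity. -/
noncomputable def extendById {E T M : Type*} (e : E → M) (H : T → E → E) (p : T × M) : M := by
  classical
  exact if h : p.2 ∈ range e then e (H p.1 h.choose) else p.2

theorem extendById_apply {E T M : Type*} {e : E → M} (he : Function.Injective e) (H : T → E → E)
    (t : T) (x : E) : extendById e H (t, e x) = e (H t x) := by
  have h : e x ∈ range e := ⟨x, rfl⟩
  rw [extendById, dif_pos h, he h.choose_spec]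

theorem extendById_of_notMem {E T M : Type*} {e : E → M} (H : T → E → E)
    (t : T) {m : M} (h : m ∉ range e) : extendById e H (t, m) = m := by
  rw [extendById, dif_neg h]

theorem bijective_extendById {E T M : Type*} {e : E → M} (he : Function.Injective e) (H : T → E → E)
    {t : T} (ht : Function.Bijective (H t)) :
    Function.Bijective fun m => extendById e H (t, m) := by
  constructor
  · intro m m' h
    by_cases hm : m ∈ range e <;> by_cases hm' : m' ∈ range e
    · obtain ⟨x, rfl⟩ := hm
      obtain ⟨y, rfl⟩ := hm'
      simp only [extendById_apply he] at h
      rw [ht.1 (he h)]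
    · obtain ⟨x, rfl⟩ := hm
      simp only [extendById_apply he, extendById_of_notMem H t hm'] at h
      exact absurd ⟨_, h⟩ hm'
    · obtain ⟨x, rfl⟩ := hm'
      simp only [extendById_apply he, extendById_of_notMem H t hm] at h
      exact absurd ⟨_, h.symm⟩ hm
    · simpa only [extendById_of_notMem H t hm, extendById_of_notMem H t hm'] using h
  · intro m
    by_cases hm : m ∈ range e
    · obtain ⟨x, rfl⟩ := hm
      obtain ⟨y, rfl⟩ := ht.2 x
      exact ⟨e y, extendById_apply he H t y⟩
    · exact ⟨m, extendById_of_notMem H t hm⟩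

/-- A contraction cannot cancel the displacement of two distinct points; a preimage of `y` is the
Banach fixed point of `x ↦ y - u x`. -/
theorem bijective_add_of_lipschitzWith {E : Type*} [NormedAddCommGroup E] [CompleteSpace E]
    {u : E → E} {K : NNReal} (hK : K < 1) (hu : LipschitzWith K u) :
    Function.Bijective fun x => x + u x := by
  constructor
  · intro x y h
    by_contra hxy
    have h1 : dist x y = dist (u x) (u y) := by
      have h2 : x - y = -(u x - u y) := by
        have : x + u x = y + u y := h
        rw [neg_sub, sub_eq_sub_iff_add_eq_add, add_comm (u y), this]
      rw [dist_eq_norm, dist_eq_norm, h2, norm_neg]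
    have h2 := hu.dist_le_mul x y
    rw [← h1] at h2
    have h3 : 0 < dist x y := dist_pos.2 hxy
    have h4 : (K : ℝ) < 1 := by exact_mod_cast hK
    nlinarith
  · intro y
    have hc : ContractingWith K fun x => y - u x :=
      ⟨hK, LipschitzWith.of_dist_le_mul fun a b => by
        rw [dist_sub_left]; exact hu.dist_le_mul a b⟩
    have h2 : y - u hc.fixedPoint = hc.fixedPoint := hc.fixedPoint_isFixedPt
    exact ⟨hc.fixedPoint, (sub_eq_iff_eq_add.1 h2).symm⟩

/-- Off the compact, hence closed, set `e '' K` the map is the second projection, which settles the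
points outside the open range of `e`. Continuity is joint in the parameter so that currying gives a
path of homeomorphisms. -/
theorem continuous_extendById {E T M : Type*} [TopologicalSpace E] [TopologicalSpace T]
    [TopologicalSpace M] [T2Space M] {e : E → M}
    (he : IsOpenEmbedding e) {H : T → E → E} (hH : Continuous fun p : T × E => H p.1 p.2)
    {K : Set E} (hK : IsCompact K) (hHK : ∀ t, ∀ x ∉ K, H t x = x) :
    Continuous (extendById e H) := by
  rw [continuous_iff_continuousAt]
  rintro ⟨t, m⟩
  by_cases hm : m ∈ range e
  · obtain ⟨x, rfl⟩ := hm
    have hφ : IsOpenEmbedding (Prod.map id e : T × E → T × M) := IsOpenEmbedding.id.prodMap he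
    refine (hφ.continuousAt_iff (x := (t, x))).1 (Continuous.continuousAt ?_)
    have : extendById e H ∘ Prod.map id e = fun p => e (H p.1 p.2) := by
      ext p
      exact extendById_apply he.injective H p.1 p.2
    rw [this]
    exact he.continuous.comp hH
  · have hopen : IsOpen (Prod.snd ⁻¹' (e '' K)ᶜ : Set (T × M)) :=
      (hK.image he.continuous).isClosed.isOpen_compl.preimage continuous_snd
    have hmem : (t, m) ∈ (Prod.snd ⁻¹' (e '' K)ᶜ : Set (T × M)) := fun ⟨x, _, hx⟩ => hm ⟨x, hx⟩
    refine continuousAt_snd.congr ?_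
    filter_upwards [hopen.mem_nhds hmem] with p hp
    by_cases hp' : p.2 ∈ range e
    · obtain ⟨t', m'⟩ := p
      obtain ⟨x, rfl⟩ := hp'
      rw [extendById_apply he.injective, hHK t' x fun hx => hp ⟨x, hx, rfl⟩]
    · exact (extendById_of_notMem H p.1 hp').symm

section Supported

variable (d : ℕ) {M : Type*} [TopologicalSpace M] [T2Space M] [CompactSpace M]

instance homeoMulAction (M : Type*) [TopologicalSpace M] : MulAction (M ≃ₜ M) M where
  smul f x := f x
  one_smul _ := rfl
  mul_smul _ _ _ := rfl

/-- The elements of `Homeo₀ d M` that are the identity outside `D`. -/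
def supportedIn (D : Set M) : Subgroup (Homeo₀ d M) where
  carrier := {f | ∀ x ∉ D, f • x = x}
  one_mem' := fun x _ => one_smul _ x
  mul_mem' := by
    intro f g hf hg x hx
    rw [mul_smul, hg x hx, hf x hx]
  inv_mem' := by
    intro f hf x hx
    rw [inv_smul_eq_iff, hf x hx]

variable {d}

theorem smul_mem_iff_of_mem_supportedIn {D : Set M} {f : Homeo₀ d M} (hf : f ∈ supportedIn d D)
    {x : M} : f • x ∈ D ↔ x ∈ D := by
  constructor
  · intro h
    by_contra hx
    exact hx (hf x hx ▸ h)
  · intro h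
    by_contra hx
    have h1 := (supportedIn d D).inv_mem hf _ hx
    rw [inv_smul_smul] at h1
    exact hx (h1 ▸ h)

theorem continuous_homeo₀_smul (f : Homeo₀ d M) : Continuous fun x : M => f • x :=
  f.1.1.continuous

theorem continuous_homeo₀_coe : Continuous fun f : Homeo₀ d M => f.1.1 :=
  continuous_subtype_val.comp continuous_subtype_val

variable {e : EuclideanSpace ℝ (Fin d) → M}

/-- A compactly supported contraction `u` of Euclidean space gives an element `x ↦ x + u x` of
`Homeo₀ d M` supported in an open Euclidean piece of `M`. -/
theorem exists_mem_supportedIn_forall_eq_add (he : IsOpenEmbedding e)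
    {u : EuclideanSpace ℝ (Fin d) → EuclideanSpace ℝ (Fin d)} {K : NNReal} (hK : K < 1)
    (hu : LipschitzWith K u) (hc : HasCompactSupport u) :
    ∃ f ∈ supportedIn d (range e), ∀ x, f • e x = e (x + u x) := by
  -- Each `t • u` is again a contraction, so this isotopy is a path of homeomorphisms from the
  -- identity; its end therefore lies in the identity component.
  let H : unitInterval → EuclideanSpace ℝ (Fin d) → EuclideanSpace ℝ (Fin d) :=
    fun t x => x + (t : ℝ) • u x
  have hH : Continuous fun p : unitInterval × EuclideanSpace ℝ (Fin d) => H p.1 p.2 := by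
    have := hu.continuous
    fun_prop
  have hHK : ∀ t, ∀ x ∉ tsupport u, H t x = x := fun t x hx => by
    simp [H, image_eq_zero_of_notMem_tsupport hx]
  have hcont := continuous_extendById he hH hc.isCompact hHK
  have hbij : ∀ t, Function.Bijective fun m => extendById e H (t, m) := fun t => by
    refine bijective_extendById he.injective H (bijective_add_of_lipschitzWith hK ?_)
    refine LipschitzWith.of_dist_le_mul fun a b => ?_
    rw [dist_smul₀, Real.norm_of_nonneg t.2.1]
    exact (mul_le_of_le_one_left dist_nonneg t.2.2).trans (hu.dist_le_mul a b)
  let F : unitInterval → (M ≃ₜ M) := fun t =>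
    Continuous.homeoOfEquivCompactToT2 (f := Equiv.ofBijective _ (hbij t))
      (hcont.comp (Continuous.prodMk_right t))
  have hF : ∀ t m, F t m = extendById e H (t, m) := fun _ _ => rfl
  have hFfix : ∀ t, F t ∈ homeoFixingBoundary d M := fun t x hx => by
    rw [hF, extendById_of_notMem]
    exact fun h => hx (range_subset_manifoldInterior he h)
  let G : unitInterval → homeoFixingBoundary d M := fun t => ⟨F t, hFfix t⟩
  have hG : Continuous G := by
    refine Continuous.subtype_mk (continuous_induced_rng.2 ?_) _
    exact (ContinuousMap.curry ⟨_, hcont⟩).continuous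
  have hG0 : G 0 = 1 := by
    refine Subtype.ext (Homeomorph.ext fun m => ?_)
    change extendById e H (0, m) = m
    by_cases hm : m ∈ range e
    · obtain ⟨x, rfl⟩ := hm
      rw [extendById_apply he.injective]
      simp [H]
    · exact extendById_of_notMem H 0 hm
  have hG1 : G 1 ∈ Subgroup.connectedComponentOfOne (homeoFixingBoundary d M) :=
    (isPreconnected_range hG).subset_connectedComponent ⟨0, hG0⟩ ⟨1, rfl⟩
  refine ⟨⟨G 1, hG1⟩, fun m hm => extendById_of_notMem H 1 hm, fun x => ?_⟩
  refine (extendById_apply he.injective H 1 x).trans ?_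
  simp [H]

end Supported

/-! ### Explicit contractions with compact support. -/

section Bump

variable {E : Type*} [NormedAddCommGroup E]

/-- The cone of height `1` over the ball of radius `r` around `a`. -/
noncomputable def cone (a : E) (r : ℝ) (x : E) : ℝ := max 0 (1 - dist x a / r)

theorem cone_nonneg (a : E) (r : ℝ) (x : E) : 0 ≤ cone a r x := le_max_left _ _

theorem cone_le_one (a : E) {r : ℝ} (hr : 0 < r) (x : E) : cone a r x ≤ 1 :=
  max_le zero_le_one (by have := div_nonneg (dist_nonneg (x := x) (y := a)) hr.le; linarith)

theorem cone_self (a : E) (r : ℝ) : cone a r a = 1 := by simp [cone]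

theorem cone_eq_zero {a : E} {r : ℝ} (hr : 0 < r) {x : E} (hx : r ≤ dist x a) :
    cone a r x = 0 :=
  max_eq_left (by have := (one_le_div hr).2 hx; linarith)

theorem abs_cone_sub_cone_le (a : E) {r : ℝ} (hr : 0 < r) (x y : E) :
    |cone a r x - cone a r y| ≤ dist x y / r := by
  refine (abs_max_sub_max_le_max _ _ _ _).trans ?_
  rw [sub_self, abs_zero, max_eq_right (abs_nonneg _)]
  have : 1 - dist x a / r - (1 - dist y a / r) = (dist y a - dist x a) / r := by ring
  rw [this, abs_div, abs_of_pos hr, dist_comm x y]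
  gcongr
  exact abs_dist_sub_le y x a

theorem support_cone_subset (a : E) {r : ℝ} (hr : 0 < r) :
    Function.support (cone a r) ⊆ Metric.closedBall a r := by
  intro x hx
  by_contra h
  exact hx (cone_eq_zero hr (not_le.1 h).le)

variable [NormedSpace ℝ E]

theorem lipschitzWith_cone_smul (a : E) {r : ℝ} (hr : 0 < r) {v : E} (hv : ‖v‖ ≤ r / 2) :
    LipschitzWith (1 / 2) fun x => cone a r x • v := by
  refine LipschitzWith.of_dist_le_mul fun x y => ?_
  rw [dist_eq_norm, ← sub_smul, norm_smul, Real.norm_eq_abs]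
  calc _ ≤ dist x y / r * (r / 2) := by
        gcongr
        exact abs_cone_sub_cone_le a hr x y
    _ = _ := by
      push_cast
      field_simp

/-- By the product rule `cone • (x - a)` has Lipschitz constant 2: the cone has slope `1 / r` and
vanishes where `x - a` is longer than `r`. The factor 1/4 brings the constant down to 1/2. -/
theorem lipschitzWith_cone_smul_sub (a : E) {r : ℝ} (hr : 0 < r) :
    LipschitzWith (1 / 2) fun x => -((cone a r x / 4) • (x - a)) := by
  refine LipschitzWith.of_dist_le_mul fun x y => ?_
  -- It suffices that one of the two points lies in the ball; when neither does, both terms vanish.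
  have key : ∀ x y : E, dist x a ≤ r →
      ‖cone a r x • (x - a) - cone a r y • (y - a)‖ ≤ 2 * dist x y := by
    intro x y hx
    have h1 : cone a r x • (x - a) - cone a r y • (y - a) =
        cone a r y • (x - y) + (cone a r x - cone a r y) • (x - a) := by module
    rw [h1]
    refine (norm_add_le _ _).trans ?_
    rw [norm_smul, norm_smul, Real.norm_eq_abs, Real.norm_eq_abs, abs_of_nonneg (cone_nonneg _ _ _),
      ← dist_eq_norm, ← dist_eq_norm]
    have h2 : cone a r y * dist x y ≤ dist x y :=
      mul_le_of_le_one_left dist_nonneg (cone_le_one a hr y)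
    have h3 : |cone a r x - cone a r y| * dist x a ≤ dist x y / r * r := by
      gcongr
      exact abs_cone_sub_cone_le a hr x y
    rw [div_mul_cancel₀ _ hr.ne'] at h3
    linarith
  have key2 : ‖cone a r x • (x - a) - cone a r y • (y - a)‖ ≤ 2 * dist x y := by
    by_cases hx : dist x a ≤ r
    · exact key x y hx
    by_cases hy : dist y a ≤ r
    · rw [norm_sub_rev, dist_comm]
      exact key y x hy
    · rw [cone_eq_zero hr (not_le.1 hx).le, cone_eq_zero hr (not_le.1 hy).le]
      simp [dist_nonneg]
  have h4 : -((cone a r x / 4) • (x - a)) - -((cone a r y / 4) • (y - a)) =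
      (-1 / 4 : ℝ) • (cone a r x • (x - a) - cone a r y • (y - a)) := by module
  rw [dist_eq_norm, h4, norm_smul]
  norm_num
  linarith

end Bump

/-! ### Moving points and squeezing balls. -/

section Moves

variable {d : ℕ} {M : Type*} [TopologicalSpace M] [T2Space M] [CompactSpace M]
variable {e : EuclideanSpace ℝ (Fin d) → M}

/-- The displacement `y - x`, weighted by a cone around `x` whose ball misses `F`, is a contraction
once `y` is within half the radius. -/
theorem eventually_exists_smul_eq (he : IsOpenEmbedding e) {F : Set (EuclideanSpace ℝ (Fin d))}
    (hF : F.Finite) {x : EuclideanSpace ℝ (Fin d)} (hx : x ∉ F) :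
    ∀ᶠ y in 𝓝 x, ∃ f ∈ supportedIn d (range e), f • e x = e y ∧ ∀ z ∈ F, f • e z = e z := by
  obtain ⟨r, hr, hrF⟩ := Metric.isOpen_iff.1 hF.isClosed.isOpen_compl x hx
  filter_upwards [Metric.closedBall_mem_nhds x (half_pos hr)] with y hy
  obtain ⟨f, hf, hfu⟩ := exists_mem_supportedIn_forall_eq_add he (K := 1 / 2) (by
      rw [← NNReal.coe_lt_coe]; norm_num)
    (lipschitzWith_cone_smul x hr (v := y - x) (by rwa [← dist_eq_norm]))
    (HasCompactSupport.of_support_subset_isCompact (isCompact_closedBall x r)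
      ((Function.support_smul_subset_left _ _).trans (support_cone_subset x hr)))
  refine ⟨f, hf, ?_, fun z hz => ?_⟩
  · rw [hfu, cone_self, one_smul, add_sub_cancel]
  · rw [hfu, cone_eq_zero hr, zero_smul, add_zero]
    by_contra h
    exact hrF (not_le.1 h) hz

/-- Being joined by such a homeomorphism is an equivalence relation that holds locally, and the
complement of a finite set is connected in dimension at least 2. -/
theorem exists_smul_eq_of_notMem (he : IsOpenEmbedding e) (hd : 2 ≤ d)
    {F : Set (EuclideanSpace ℝ (Fin d))} (hF : F.Finite) {x y : EuclideanSpace ℝ (Fin d)}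
    (hx : x ∉ F) (hy : y ∉ F) :
    ∃ f ∈ supportedIn d (range e), f • e x = e y ∧ ∀ z ∈ F, f • e z = e z := by
  have hrank : 1 < Module.rank ℝ (EuclideanSpace ℝ (Fin d)) := by
    rw [← Module.finrank_eq_rank, finrank_euclideanSpace_fin]
    exact_mod_cast hd
  refine (hF.countable.isConnected_compl_of_one_lt_rank hrank).isPreconnected.induction₂
    (fun x y => ∃ f ∈ supportedIn d (range e), f • e x = e y ∧ ∀ z ∈ F, f • e z = e z)
    (fun x hx => (eventually_exists_smul_eq he hF hx).filter_mono nhdsWithin_le_nhds) ?_ ?_ hx hy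
  · rintro x y z - - - ⟨f, hf, hfx, hfF⟩ ⟨g, hg, hgx, hgF⟩
    refine ⟨g * f, mul_mem hg hf, by rw [mul_smul, hfx, hgx], fun w hw => ?_⟩
    rw [mul_smul, hfF w hw, hgF w hw]
  · rintro x y - - ⟨f, hf, hfx, hfF⟩
    refine ⟨f⁻¹, inv_mem hf, by rw [inv_smul_eq_iff, hfx], fun w hw => ?_⟩
    rw [inv_smul_eq_iff, hfF w hw]

/-- `Homeo₀ d M` acts transitively on finite tuples of distinct points of a Euclidean piece. -/
theorem exists_forall_smul_eq (he : IsOpenEmbedding e) (hd : 2 ≤ d) {κ : Type*} [Finite κ]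
    {x y : κ → EuclideanSpace ℝ (Fin d)} (hx : Function.Injective x) (hy : Function.Injective y) :
    ∃ f ∈ supportedIn d (range e), ∀ k, f • e (x k) = e (y k) := by
  classical
  have := Fintype.ofFinite κ
  suffices h : ∀ s : Finset κ, ∃ f ∈ supportedIn d (range e), ∀ k ∈ s, f • e (x k) = e (y k) by
    obtain ⟨f, hf, hfx⟩ := h Finset.univ
    exact ⟨f, hf, fun k => hfx k (Finset.mem_univ k)⟩
  intro s
  induction s using Finset.induction_on with
  | empty => exact ⟨1, one_mem _, by simp⟩
  | insert k s hk ih =>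
    obtain ⟨f, hf, hfx⟩ := ih
    obtain ⟨z, hz⟩ : f • e (x k) ∈ range e := (smul_mem_iff_of_mem_supportedIn hf).2 ⟨_, rfl⟩
    obtain ⟨g, hg, hgz, hgF⟩ := exists_smul_eq_of_notMem he hd (F := y '' s)
      (s.finite_toSet.image y) (x := z) (y := y k) (by
        rintro ⟨j, hj, hjz⟩
        rw [← hjz, ← hfx j hj] at hz
        have := hx (he.injective (MulAction.injective f hz))
        exact hk (this ▸ hj)) (by
        rintro ⟨j, hj, hjk⟩
        exact hk (hy hjk ▸ hj))
    refine ⟨g * f, mul_mem hg hf, fun j hj => ?_⟩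
    rw [mul_smul]
    rcases Finset.mem_insert.1 hj with rfl | hj
    · rw [← hz, hgz]
    · rw [hfx j hj, hgF _ ⟨j, hj, rfl⟩]

/-- Squeezing a ball into a neighbourhood of its centre. -/
theorem exists_forall_smul_mem (he : IsOpenEmbedding e) (a : EuclideanSpace ℝ (Fin d)) {δ : ℝ}
    (hδ : 0 < δ) {V : Set M} (hV : V ∈ 𝓝 (e a)) :
    ∃ f ∈ supportedIn d (range e), (∀ x ∈ Metric.closedBall a δ, f • e x ∈ V) ∧
      ∀ x, 2 * δ ≤ dist x a → f • e x = e x := by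
  have h2δ : 0 < 2 * δ := by positivity
  obtain ⟨f, hf, hfu⟩ := exists_mem_supportedIn_forall_eq_add he (K := 1 / 2) (by
      rw [← NNReal.coe_lt_coe]; norm_num)
    (lipschitzWith_cone_smul_sub a h2δ)
    (HasCompactSupport.of_support_subset_isCompact (isCompact_closedBall a (2 * δ)) (by
      refine Subset.trans (fun x hx => ?_) (support_cone_subset a h2δ)
      contrapose! hx
      simp_all))
  -- Within distance `δ` of `a` the cone of radius `2 * δ` is at least 1/2, so the factor `1 - cone
  -- / 4` is at most 7/8. A high power of `f` then squeezes the ball.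
  have hstep : ∀ x, ∃ y, f • e x = e y ∧ dist y a ≤ dist x a ∧
      (dist x a ≤ δ → dist y a ≤ 7 / 8 * dist x a) := by
    intro x
    refine ⟨_, hfu x, ?_⟩
    have h1 : dist (x + -((cone a (2 * δ) x / 4) • (x - a))) a =
        (1 - cone a (2 * δ) x / 4) * dist x a := by
      have : x + -((cone a (2 * δ) x / 4) • (x - a)) - a =
        (1 - cone a (2 * δ) x / 4) • (x - a) := by module
      rw [dist_eq_norm, this, norm_smul, Real.norm_of_nonneg, dist_eq_norm]
      linarith [cone_le_one a h2δ x]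
    rw [h1]
    refine ⟨mul_le_of_le_one_left dist_nonneg (by linarith [cone_nonneg a (2 * δ) x]), fun hx => ?_⟩
    gcongr
    have : 1 - dist x a / (2 * δ) ≤ cone a (2 * δ) x := le_max_right _ _
    have : dist x a / (2 * δ) ≤ 1 / 2 := by
      rw [div_le_iff₀ h2δ]; linarith
    linarith
  have hpow : ∀ k : ℕ, ∀ x ∈ Metric.closedBall a δ, ∃ y, f ^ k • e x = e y ∧
      dist y a ≤ (7 / 8) ^ k * δ := by
    intro k x hx
    induction k with
    | zero => exact ⟨x, by simp, by simpa using hx⟩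
    | succ k ih =>
      obtain ⟨y, hy, hya⟩ := ih
      obtain ⟨z, hz, -, hza⟩ := hstep y
      have h1 : (7 / 8 : ℝ) ^ k ≤ 1 := pow_le_one₀ (by norm_num) (by norm_num)
      refine ⟨z, by rw [pow_succ', mul_smul, hy, hz], (hza ?_).trans ?_⟩
      · exact hya.trans (mul_le_of_le_one_left hδ.le h1)
      · rw [pow_succ']
        linarith
  obtain ⟨ε, hε, hεV⟩ := Metric.mem_nhds_iff.1 (he.continuous.continuousAt.preimage_mem_nhds hV)
  obtain ⟨k, hk⟩ := exists_pow_lt_of_lt_one (div_pos hε hδ) (show (7 / 8 : ℝ) < 1 by norm_num)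
  refine ⟨f ^ k, pow_mem hf k, fun x hx => ?_, fun x hx => ?_⟩
  · obtain ⟨y, hy, hya⟩ := hpow k x hx
    rw [hy]
    refine hεV (hya.trans_lt ?_)
    rwa [lt_div_iff₀ hδ] at hk
  · have : f • e x = e x := by
      rw [hfu, cone_eq_zero h2δ hx]
      simp
    clear hpow hk
    induction k with
    | zero => simp
    | succ k ih => rw [pow_succ, mul_smul, this, ih]

/-- Squeezing finitely many balls at the same time, without moving some other balls. -/
theorem exists_forall_forall_smul_mem (he : IsOpenEmbedding e) {ι : Type*}
    {a : ι → EuclideanSpace ℝ (Fin d)} {δ : ℝ} (hδ : 0 < δ)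
    (ha : Pairwise fun s t => 3 * δ ≤ dist (a s) (a t)) {V : ι → Set M}
    (hV : ∀ s, V s ∈ 𝓝 (e (a s))) (J : Finset ι) :
    ∃ f ∈ supportedIn d (range e), (∀ s ∈ J, ∀ x ∈ Metric.closedBall (a s) δ, f • e x ∈ V s) ∧
      ∀ s ∉ J, ∀ x ∈ Metric.closedBall (a s) δ, f • e x = e x := by
  classical
  induction J using Finset.induction_on with
  | empty => exact ⟨1, one_mem _, by simp, fun s _ x _ => one_smul _ _⟩
  | insert j J hj ih =>
    obtain ⟨f, hf, hfV, hfa⟩ := ih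
    -- The target is also cut down to the ball around `a j`, where `f` is the identity, so that `f`
    -- does not spoil the squeezing done by `g`.
    obtain ⟨g, hg, hgV, hga⟩ := exists_forall_smul_mem he (a j) hδ
      (Filter.inter_mem (hV j)
        (he.isOpenMap.image_mem_nhds (Metric.closedBall_mem_nhds (a j) hδ)))
    have hfar : ∀ s ≠ j, ∀ x ∈ Metric.closedBall (a s) δ, g • e x = e x := fun s hs x hx => by
      refine hga x ?_
      have h1 := ha hs
      have h2 : dist x (a s) ≤ δ := hx
      have h3 := dist_triangle_left (a s) (a j) x
      linarith
    refine ⟨f * g, mul_mem hf hg, fun s hs x hx => ?_, fun s hs x hx => ?_⟩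
    · rw [mul_smul]
      rcases eq_or_ne s j with rfl | hsj
      · obtain ⟨hgx, y, hy, hyg⟩ := hgV x hx
        rw [← hyg] at hgx ⊢
        rwa [hfa s hj y hy]
      · rw [hfar s hsj x hx]
        exact hfV s ((Finset.mem_insert.1 hs).resolve_left hsj) x hx
    · have hsj : s ≠ j := fun h => hs (h ▸ Finset.mem_insert_self j J)
      rw [mul_smul, hfar s hsj x hx]
      exact hfa s (fun h => hs (Finset.mem_insert_of_mem h)) x hx

end Moves

theorem exists_injective_forall_mem {X ι : Type*} [Countable ι] {s : Set X} (hs : s.Infinite) :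
    ∃ a : ι → X, Function.Injective a ∧ ∀ i, a i ∈ s := by
  obtain ⟨f, hf⟩ := exists_injective_nat ι
  exact ⟨fun i => hs.natEmbedding s (f i),
    fun i j h => hf ((hs.natEmbedding s).injective (Subtype.ext h)), fun i => Subtype.coe_prop _⟩

/-- This is the finite Baire property inside `N`; openness of each `D i` lets the intersection
shrink one set at a time. -/
theorem nonempty_inter_biInter {X ι : Type*} [TopologicalSpace X] {D : ι → Set X}
    (hD : ∀ i, IsOpen (D i)) (J : Finset ι) {N : Set X} (hN : IsOpen N) (hne : N.Nonempty)
    (hND : ∀ i, N ⊆ closure (D i)) : (N ∩ ⋂ i ∈ J, D i).Nonempty := by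
  classical
  induction J using Finset.induction_on generalizing N with
  | empty => simpa using hne
  | insert j J hj ih =>
    obtain ⟨x, hx⟩ := hne
    obtain ⟨y, hyN, hyD⟩ := mem_closure_iff.1 (hND j hx) N hN hx
    have := ih (hN.inter (hD j)) ⟨y, hyN, hyD⟩ fun i => inter_subset_left.trans (hND i)
    rwa [Finset.set_biInter_insert, ← inter_assoc]

/-! ### Making a homeomorphism play ping-pong. -/

section Squeeze

variable {d : ℕ} {M : Type*} [TopologicalSpace M] [T2Space M] [CompactSpace M]
variable {e : EuclideanSpace ℝ (Fin d) → M}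

theorem infinite_of_mem_nhds_euclidean (hd : 2 ≤ d) {x : EuclideanSpace ℝ (Fin d)}
    {s : Set (EuclideanSpace ℝ (Fin d))} (hs : s ∈ 𝓝 x) : s.Infinite := by
  have : Nonempty (Fin d) := ⟨⟨0, by omega⟩⟩
  have := Module.punctured_nhds_neBot ℝ (EuclideanSpace ℝ (Fin d)) x
  exact infinite_of_mem_nhds x hs

/-- First `p` corrects `g` at finitely many points: `p * g` sends the centres other than `a r` into
ball `s`, and its inverse sends the centres other than `a s` into ball `r`. By continuity this
persists on small neighbourhoods of those centres, into which `k` and `l` squeeze the balls. As `k`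
fixes ball `r` and `l` fixes ball `s`, the product `l⁻¹ * p * g * k` has both properties. -/
theorem exists_squeeze (he : IsOpenEmbedding e) (hd : 2 ≤ d) {ι : Type*} [Fintype ι]
    {a : ι → EuclideanSpace ℝ (Fin d)} {δ : ℝ} (hδ : 0 < δ)
    (ha : Pairwise fun s t => 3 * δ ≤ dist (a s) (a t)) (g : Homeo₀ d M)
    (hg : ∀ s, ∀ x ∈ Metric.ball (a s) δ, g • e x ∈ range e) (s r : ι) :
    ∃ h ∈ supportedIn d (range e), ∃ k ∈ supportedIn d (range e),
      (∀ t ≠ r, ∀ x ∈ Metric.closedBall (a t) δ,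
        (h * g * k) • e x ∈ e '' Metric.ball (a s) δ) ∧
      (∀ t ≠ s, ∀ x ∈ Metric.closedBall (a t) δ,
        (h * g * k)⁻¹ • e x ∈ e '' Metric.ball (a r) δ) := by
  classical
  have hainj : Function.Injective a := fun i j hij => by
    by_contra h
    have : 3 * δ ≤ dist (a i) (a j) := ha h
    rw [hij, dist_self] at this
    linarith
  have hball : ∀ i j, i ≠ j → ∀ x ∈ Metric.ball (a i) δ, x ≠ a j := by
    rintro i j hij x hx rfl
    have : 3 * δ ≤ dist (a i) (a j) := ha hij
    rw [dist_comm] at this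
    have : dist (a j) (a i) < δ := hx
    linarith
  obtain ⟨b, hbinj, hb⟩ := exists_injective_forall_mem (ι := ι)
    (infinite_of_mem_nhds_euclidean hd (Metric.ball_mem_nhds (a s) hδ))
  obtain ⟨c, hcinj, hc⟩ := exists_injective_forall_mem (ι := ι)
    (infinite_of_mem_nhds_euclidean hd (Metric.ball_mem_nhds (a r) hδ))
  -- Both requirements on `p` are imposed at once: `p * g` is to send `a t` to `b t` for `t ≠ r`,
  -- and `c t` to `a t` for `t ≠ s`. Disjointness of the balls makes sources and targets distinct.
  let q : {t // t ≠ r} ⊕ {t // t ≠ s} → EuclideanSpace ℝ (Fin d) :=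
    Sum.elim (fun t => a t) (fun t => c t)
  let y : {t // t ≠ r} ⊕ {t // t ≠ s} → EuclideanSpace ℝ (Fin d) :=
    Sum.elim (fun t => b t) (fun t => a t)
  have hqinj : Function.Injective q :=
    Function.Injective.sumElim (hainj.comp Subtype.val_injective)
      (hcinj.comp Subtype.val_injective)
      fun i j h => hball r i i.2.symm _ (hc j) h.symm
  have hyinj : Function.Injective y :=
    Function.Injective.sumElim (hbinj.comp Subtype.val_injective)
      (hainj.comp Subtype.val_injective)
      fun i j h => hball s j j.2.symm _ (hb i) h
  have hqg : ∀ k, g • e (q k) ∈ range e := by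
    rintro (t | t)
    · exact hg t _ (Metric.mem_ball_self hδ)
    · exact hg r _ (hc t)
  choose x hx using hqg
  have hxinj : Function.Injective x := fun i j hij =>
    hqinj (he.injective (MulAction.injective g (by simp only [← hx, hij])))
  obtain ⟨p, hp, hpx⟩ := exists_forall_smul_eq (M := M) he hd hxinj hyinj
  simp only [hx] at hpx
  have hopen : ∀ t, IsOpen (e '' Metric.ball (a t) δ) := fun t =>
    he.isOpenMap _ Metric.isOpen_ball
  have hcs : ∀ f : Homeo₀ d M, Continuous fun m : M => f • m := continuous_homeo₀_smul
  obtain ⟨k, hk, hkV, hkr⟩ := exists_forall_forall_smul_mem (M := M) he hδ ha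
    (V := fun t => if t = r then univ else (fun m => (p * g) • m) ⁻¹' (e '' Metric.ball (a s) δ))
    (fun t => by
      split_ifs with htr
      · exact Filter.univ_mem
      · refine ((hopen s).preimage (hcs (p * g))).mem_nhds ?_
        have := hpx (Sum.inl ⟨t, htr⟩)
        rw [mem_preimage, mul_smul]
        exact ⟨b t, hb t, this.symm⟩) (Finset.univ.erase r)
  obtain ⟨l, hl, hlV, hls⟩ := exists_forall_forall_smul_mem (M := M) he hδ ha
    (V := fun t => if t = s then univ else
      (fun m => (p * g)⁻¹ • m) ⁻¹' (e '' Metric.ball (a r) δ))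
    (fun t => by
      split_ifs with hts
      · exact Filter.univ_mem
      · refine ((hopen r).preimage (hcs (p * g)⁻¹)).mem_nhds ?_
        have := hpx (Sum.inr ⟨t, hts⟩)
        refine ⟨c t, hc t, ?_⟩
        rw [eq_inv_smul_iff, mul_smul]
        exact this) (Finset.univ.erase s)
  refine ⟨l⁻¹ * p, mul_mem (inv_mem hl) hp, k, hk, fun t ht z hz => ?_, fun t ht z hz => ?_⟩
  · have h1 := hkV t (by simpa using ht) z hz
    rw [if_neg ht] at h1
    obtain ⟨w, hw, hwz⟩ := h1
    refine ⟨w, hw, ?_⟩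
    have h2 := hls s (by simp) w (Metric.ball_subset_closedBall hw)
    rw [mul_assoc l⁻¹, mul_assoc l⁻¹, mul_smul, mul_smul, eq_inv_smul_iff, h2]
    exact hwz
  · have h1 := hlV t (by simpa using ht) z hz
    rw [if_neg ht] at h1
    obtain ⟨w, hw, hwz⟩ := h1
    refine ⟨w, hw, ?_⟩
    have h2 := hkr r (by simp) w (Metric.ball_subset_closedBall hw)
    rw [eq_inv_smul_iff, mul_smul, h2, hwz]
    simp [mul_smul]

end Squeeze

/-! ### Euclidean pieces near a boundary point. -/

section Chart

variable {d : ℕ} [NeZero d] {M : Type*} [TopologicalSpace M]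

theorem continuous_val_halfSpace : Continuous (fun x : EuclideanHalfSpace d => x.1) :=
  continuous_subtype_val

theorem isOpenEmbedding_symm_comp {E H : Type*} [TopologicalSpace E] [TopologicalSpace H]
    (ψ : OpenPartialHomeomorph M H) {j : E → H} (hj : IsOpenEmbedding j)
    (hjt : ∀ x, j x ∈ ψ.target) : IsOpenEmbedding (ψ.symm ∘ j) := by
  refine .of_continuous_injective_isOpenMap ?_ ?_ ?_
  · exact ψ.symm.continuousOn.comp_continuous hj.continuous hjt
  · exact fun x y h => hj.injective (ψ.symm.injOn (hjt x) (hjt y) h)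
  · intro O hO
    rw [image_comp]
    refine ψ.symm.isOpen_image_of_subset_source (hj.isOpenMap O hO) ?_
    rintro _ ⟨x, -, rfl⟩
    exact hjt x

/-- An open convex bounded subset of the open half-space is an open copy of Euclidean space in the
closed half-space. -/
theorem exists_isOpenEmbedding_halfSpace {s : Set (EuclideanSpace ℝ (Fin d))} (ho : IsOpen s)
    (hc : Convex ℝ s) (hne : s.Nonempty) (hb : Bornology.IsBounded s) (hs : ∀ x ∈ s, 0 ≤ x 0) :
    ∃ j : EuclideanSpace ℝ (Fin d) → EuclideanHalfSpace d, IsOpenEmbedding j ∧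
      range j = {x | x.1 ∈ s} := by
  -- A homeomorphism of the space takes the convex set to the open unit ball, which is itself
  -- homeomorphic to the space.
  obtain ⟨h, hh, -⟩ := exists_homeomorph_image_interior_closure_frontier_eq_unitBall hc
    (by rwa [ho.interior_eq]) hb
  rw [ho.interior_eq] at hh
  let i : EuclideanSpace ℝ (Fin d) → EuclideanSpace ℝ (Fin d) :=
    fun x => h.symm (Homeomorph.unitBall x)
  have hi : IsOpenEmbedding i := h.symm.isOpenEmbedding.comp
    (Metric.isOpen_ball.isOpenEmbedding_subtypeVal.comp Homeomorph.unitBall.isOpenEmbedding)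
  have hir : range i = s := by
    have : range i = h.symm '' Metric.ball 0 1 := by
      ext y
      constructor
      · rintro ⟨x, rfl⟩
        exact ⟨_, (Homeomorph.unitBall x).2, rfl⟩
      · rintro ⟨x, hx, rfl⟩
        exact ⟨Homeomorph.unitBall.symm ⟨x, hx⟩, by simp [i]⟩
    rw [this, ← hh, ← image_comp]
    simp
  have his : ∀ x, i x ∈ s := fun x => hir ▸ mem_range_self x
  refine ⟨fun x => ⟨i x, hs _ (his x)⟩, .of_continuous_injective_isOpenMap ?_ ?_ ?_, ?_⟩
  · exact hi.continuous.subtype_mk _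
  · exact fun x y hxy => hi.injective (congrArg Subtype.val hxy)
  · intro O hO
    convert (hi.isOpenMap O hO).preimage continuous_val_halfSpace using 1
    ext y
    constructor
    · rintro ⟨x, hx, rfl⟩
      exact ⟨x, hx, rfl⟩
    · rintro ⟨x, hx, hxy⟩
      exact ⟨x, hx, Subtype.ext hxy⟩
  · ext y
    rw [mem_ofPred_eq, ← hir]
    constructor
    · rintro ⟨x, rfl⟩
      exact ⟨x, rfl⟩
    · rintro ⟨x, hxy⟩
      exact ⟨x, Subtype.ext hxy⟩

theorem isOpen_pos_halfSpace : IsOpen {x : EuclideanSpace ℝ (Fin d) | 0 < x 0} :=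
  isOpen_lt continuous_const (by fun_prop)

theorem convex_pos_halfSpace : Convex ℝ {x : EuclideanSpace ℝ (Fin d) | 0 < x 0} :=
  convex_halfSpace_gt (f := fun x : EuclideanSpace ℝ (Fin d) => x 0)
    ⟨fun _ _ => rfl, fun _ _ => rfl⟩ 0

theorem exists_forall_dist_lt_symm_mem (ψ : OpenPartialHomeomorph M (EuclideanHalfSpace d)) {x : M}
    (hx : x ∈ ψ.source) {N : Set M} (hN : N ∈ 𝓝 x) :
    ∃ r > 0, ∀ y : EuclideanHalfSpace d, dist y.1 (ψ x).1 < r → y ∈ ψ.target ∧ ψ.symm y ∈ N := by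
  have h1 : ψ.target ∩ ψ.symm ⁻¹' N ∈ 𝓝 (ψ x) :=
    Filter.inter_mem (ψ.open_target.mem_nhds (ψ.map_source hx))
      ((ψ.tendsto_symm hx) hN)
  obtain ⟨u, hu, hut⟩ := (mem_nhds_induced (fun y : EuclideanHalfSpace d => y.1) (ψ x) _).1 h1
  obtain ⟨r, hr, hru⟩ := Metric.mem_nhds_iff.1 hu
  exact ⟨r, hr, fun y hy => hut (hru hy)⟩

theorem halfSpace_add_mem (x : EuclideanHalfSpace d) {t : ℝ} (ht : 0 ≤ t) :
    0 ≤ (x.1 + t • EuclideanSpace.single (0 : Fin d) (1 : ℝ)) 0 := by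
  have := x.2
  simp
  linarith

theorem exists_isOpenEmbedding_range_eq (ψ : OpenPartialHomeomorph M (EuclideanHalfSpace d)) {x : M}
    {r : ℝ} (hr : 0 < r) (hrt : ∀ y : EuclideanHalfSpace d, dist y.1 (ψ x).1 < r → y ∈ ψ.target) :
    ∃ e : EuclideanSpace ℝ (Fin d) → M, IsOpenEmbedding e ∧
      range e = ψ.symm '' {y | dist y.1 (ψ x).1 < r ∧ 0 < y.1 0} := by
  obtain ⟨j, hj, hjr⟩ := exists_isOpenEmbedding_halfSpace
    (s := Metric.ball (ψ x).1 r ∩ {y | 0 < y 0}) (Metric.isOpen_ball.inter isOpen_pos_halfSpace)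
    ((convex_ball _ _).inter convex_pos_halfSpace)
    ⟨(ψ x).1 + (r / 2) • EuclideanSpace.single (0 : Fin d) (1 : ℝ), by
      rw [Metric.mem_ball, dist_self_add_left, norm_smul, Real.norm_of_nonneg (by positivity)]
      simp [hr], by
      have := (ψ x).2
      simp
      linarith⟩
    (Metric.isBounded_ball.subset inter_subset_left) (fun y hy => hy.2.le)
  refine ⟨_, isOpenEmbedding_symm_comp ψ hj fun y => ?_, ?_⟩
  · have : j y ∈ {z : EuclideanHalfSpace d | z.1 ∈ Metric.ball (ψ x).1 r ∩ {y | 0 < y 0}} :=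
      hjr ▸ mem_range_self y
    exact hrt _ this.1
  · rw [range_comp, hjr]
    rfl

theorem mem_manifoldInterior_of_pos (ψ : OpenPartialHomeomorph M (EuclideanHalfSpace d)) {x : M}
    (hx : x ∈ ψ.source) (hpos : 0 < (ψ x).1 0) : x ∈ manifoldInterior d M := by
  obtain ⟨r, hr, hrt⟩ := exists_forall_dist_lt_symm_mem ψ hx Filter.univ_mem
  obtain ⟨e, he, her⟩ := exists_isOpenEmbedding_range_eq ψ hr fun y hy => (hrt y hy).1
  refine range_subset_manifoldInterior he (her ▸ ⟨ψ x, ⟨by simpa using hr, hpos⟩, ?_⟩)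
  exact ψ.left_inv hx

/-- Every point is in the interior of the closure of a small open Euclidean piece. -/
theorem exists_isOpenEmbedding_range_subset [ChartedSpace (EuclideanHalfSpace d) M] (x : M)
    {N : Set M} (hN : N ∈ 𝓝 x) :
    ∃ e : EuclideanSpace ℝ (Fin d) → M, IsOpenEmbedding e ∧ range e ⊆ N ∧
      ∃ O, IsOpen O ∧ x ∈ O ∧ O ⊆ closure (range e) := by
  let ψ := chartAt (EuclideanHalfSpace d) x
  have hx : x ∈ ψ.source := mem_chart_source _ x
  obtain ⟨r, hr, hrt⟩ := exists_forall_dist_lt_symm_mem ψ hx hN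
  obtain ⟨e, he, her⟩ := exists_isOpenEmbedding_range_eq ψ hr fun y hy => (hrt y hy).1
  refine ⟨e, he, ?_, ψ.source ∩ ψ ⁻¹' {y | dist y.1 (ψ x).1 < r}, ?_, ⟨hx, by simpa using hr⟩, ?_⟩
  · rw [her]
    rintro _ ⟨y, hy, rfl⟩
    exact (hrt y hy.1).2
  · exact ψ.isOpen_inter_preimage
      (isOpen_lt (continuous_val_halfSpace.dist continuous_const) continuous_const)
  · rintro m ⟨hm, hmr⟩
    -- Pushing the point inward, off the face of the half-space, shows that it is a limit of points
    -- of the piece.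
    let c : NNReal → EuclideanHalfSpace d := fun t =>
      ⟨(ψ m).1 + (t : ℝ) • EuclideanSpace.single (0 : Fin d) (1 : ℝ), halfSpace_add_mem _ t.2⟩
    have hc : Continuous c := Continuous.subtype_mk (by fun_prop) _
    have hc0 : c 0 = ψ m := Subtype.ext (by simp [c])
    have h1 : Filter.Tendsto (fun t => ψ.symm (c t)) (𝓝[>] 0) (𝓝 m) := by
      have h2 := (ψ.tendsto_symm hm).comp (hc0 ▸ hc.tendsto 0 : Filter.Tendsto c (𝓝 0) (𝓝 (ψ m)))
      exact h2.mono_left nhdsWithin_le_nhds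
    refine mem_closure_of_tendsto h1 ?_
    have h3 : ∀ᶠ t in 𝓝 (0 : NNReal), dist (c t).1 (ψ x).1 < r := by
      have h4 : Continuous fun t => dist (c t).1 (ψ x).1 :=
        (continuous_val_halfSpace.comp hc).dist continuous_const
      exact h4.tendsto 0 |>.eventually_lt_const (by rw [hc0]; exact hmr)
    filter_upwards [self_mem_nhdsWithin, nhdsWithin_le_nhds h3] with t ht ht'
    rw [her]
    refine ⟨c t, ⟨ht', ?_⟩, rfl⟩
    have h5 := (ψ m).2
    have h6 : (0 : ℝ) < t := by exact_mod_cast ht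
    simp [c]
    linarith

end Chart

/-- The factor 3 keeps each ball of radius `δ` clear of the balls of radius `2 * δ` around the other
centres, where their squeezes act. -/
theorem exists_pos_separated {E ι : Type*} [MetricSpace E] [Finite ι] {a : ι → E}
    (ha : Function.Injective a) {G : Set E} (hG : IsOpen G) (haG : ∀ s, a s ∈ G) :
    ∃ δ > 0, (Pairwise fun s t => 3 * δ ≤ dist (a s) (a t)) ∧ ∀ s, Metric.ball (a s) δ ⊆ G := by
  have h1 : ∀ s t, s ≠ t → ∀ᶠ δ in 𝓝[>] (0 : ℝ), 3 * δ ≤ dist (a s) (a t) := fun s t hst => by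
    have h2 : Filter.Tendsto (fun δ : ℝ => 3 * δ) (𝓝[>] 0) (𝓝 (3 * 0)) :=
      ((continuous_const_mul 3).tendsto 0).mono_left nhdsWithin_le_nhds
    rw [mul_zero] at h2
    filter_upwards [h2.eventually_lt_const (dist_pos.2 (ha.ne hst))] with δ hδ using hδ.le
  have h2 : ∀ s, ∀ᶠ δ in 𝓝[>] (0 : ℝ), Metric.ball (a s) δ ⊆ G := fun s => by
    obtain ⟨ε, hε, hεG⟩ := Metric.isOpen_iff.1 hG _ (haG s)
    filter_upwards [Ioo_mem_nhdsGT hε] with δ hδ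
    exact (Metric.ball_subset_ball hδ.2.le).trans hεG
  have h1' := Filter.eventually_all.2 fun s => Filter.eventually_all.2 fun t =>
    Filter.eventually_imp_distrib_left.2 (h1 s t)
  have h0 : ∀ᶠ δ in 𝓝[>] (0 : ℝ), 0 < δ := self_mem_nhdsWithin
  obtain ⟨δ, hδ, hδ1, hδ2⟩ := (h0.and (h1'.and (Filter.eventually_all.2 h2))).exists
  exact ⟨δ, hδ, fun s t => hδ1 s t, hδ2⟩

/-! ### Ping-pong tuples and the subgroups they generate. -/

section Tuples

variable {d : ℕ} {M : Type*} [TopologicalSpace M] [T2Space M] [CompactSpace M]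

/-- Tuples of homeomorphisms playing ping-pong on finitely many compact sets. -/
def pingPongTuples (n d : ℕ) (M : Type*) [TopologicalSpace M] [T2Space M] [CompactSpace M] :
    Set (Fin n → Homeo₀ d M) :=
  {f | ∃ A B : Option (Fin n × Bool) → Set M, (∀ s, IsCompact (A s)) ∧ (∀ s, IsOpen (B s)) ∧
    (∀ s, B s ⊆ A s) ∧ (A none).Nonempty ∧ (∀ l, Disjoint (A none) (A (some l))) ∧
    (∀ i s, s ≠ some (i, false) → ∀ x ∈ A s, f i • x ∈ B (some (i, true))) ∧
    (∀ i s, s ≠ some (i, true) → ∀ x ∈ A s, (f i)⁻¹ • x ∈ B (some (i, false)))}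

theorem isOpen_setOf_forall_smul_mem {K U : Set M} (hK : IsCompact K) (hU : IsOpen U) :
    IsOpen {f : Homeo₀ d M | ∀ x ∈ K, f • x ∈ U} :=
  (ContinuousMap.isOpen_setOfPred_mapsTo hK hU).preimage
    ((continuous_toContinuousMap M).comp continuous_homeo₀_coe)

theorem continuous_smul_const (x : M) : Continuous fun f : Homeo₀ d M => f • x :=
  (continuous_eval_const (F := C(M, M)) x).comp
    ((continuous_toContinuousMap M).comp continuous_homeo₀_coe)

theorem isOpen_pingPongTuples (n : ℕ) : IsOpen (pingPongTuples n d M) := by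
  rw [isOpen_iff_mem_nhds]
  rintro f ⟨A, B, hA, hB, hBA, hne, hdisj, hpos, hneg⟩
  have h1 : ∀ i s, s ≠ some (i, false) →
      ∀ᶠ g : Fin n → Homeo₀ d M in 𝓝 f, ∀ x ∈ A s, g i • x ∈ B (some (i, true)) :=
    fun i s hs => (continuous_apply i).continuousAt.eventually
      ((isOpen_setOf_forall_smul_mem (hA s) (hB (some (i, true)))).mem_nhds (hpos i s hs))
  have h2 : ∀ i s, s ≠ some (i, true) →
      ∀ᶠ g : Fin n → Homeo₀ d M in 𝓝 f, ∀ x ∈ A s, (g i)⁻¹ • x ∈ B (some (i, false)) :=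
    fun i s hs => (show Continuous fun g : Fin n → Homeo₀ d M => (g i)⁻¹ from
      (continuous_apply i).inv).continuousAt.eventually
      ((isOpen_setOf_forall_smul_mem (hA s) (hB (some (i, false)))).mem_nhds (hneg i s hs))
  have h1' := Filter.eventually_all.2 fun i => Filter.eventually_all.2 fun s =>
    Filter.eventually_imp_distrib_left.2 (h1 i s)
  have h2' := Filter.eventually_all.2 fun i => Filter.eventually_all.2 fun s =>
    Filter.eventually_imp_distrib_left.2 (h2 i s)
  filter_upwards [h1', h2'] with g hg1 hg2
  exact ⟨A, B, hA, hB, hBA, hne, hdisj, hg1, hg2⟩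

/-- `V` consists of the elements that keep a base point out of all the letter sets, where every
non-trivial reduced word takes it. -/
theorem exists_isOpen_of_mem_pingPongTuples {n : ℕ} {f : Fin n → Homeo₀ d M}
    (hf : f ∈ pingPongTuples n d M) : ∃ V : Set (Homeo₀ d M), IsOpen V ∧ 1 ∈ V ∧
      ∀ w ∈ Subgroup.closure (range f), w ∈ V → w = 1 := by
  obtain ⟨A, B, hA, hB, hBA, ⟨x, hx⟩, hdisj, hpos, hneg⟩ := hf
  refine ⟨⋂ l, (fun w : Homeo₀ d M => w • x) ⁻¹' (A (some l))ᶜ,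
    isOpen_iInter_of_finite fun l =>
      (hA (some l)).isClosed.isOpen_compl.preimage (continuous_smul_const x),
    mem_iInter.2 fun l => ?_, fun w hw hwV => ?_⟩
  · rw [mem_preimage, one_smul]
    exact disjoint_left.1 (hdisj l) hx
  · exact eq_one_of_pingPong f A (fun i s hs y hy => hBA _ (hpos i s hs y hy))
      (fun i s hs y hy => hBA _ (hneg i s hs y hy)) hx hw (mem_iInter.1 hwV)

theorem pingPongTuples_subset_discreteTuples (n : ℕ) :
    pingPongTuples n d M ⊆ discreteTuples n (Homeo₀ d M) := by
  intro f hf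
  obtain ⟨V, hV, h1V, hVw⟩ := exists_isOpen_of_mem_pingPongTuples hf
  refine discreteTopology_of_isOpen_singleton_one ?_
  convert hV.preimage (continuous_subtype_val (p := (· ∈ Subgroup.closure (range f)))) using 1
  ext w
  constructor
  · rintro rfl
    exact h1V
  · exact fun hw => Subtype.ext (hVw w w.2 hw)

instance : T2Space (Homeo₀ d M) :=
  T2Space.of_injective_continuous (f := fun f : Homeo₀ d M => (f.1.1 : C(M, M)))
    (fun _ _ h => Subtype.ext (Subtype.ext (Homeomorph.ext fun x => DFunLike.congr_fun h x)))
    ((continuous_toContinuousMap M).comp continuous_homeo₀_coe)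

/-- Density of the subgroup would force the isolating neighbourhood `V` to be `{1}`, a clopen set in
a connected group. -/
theorem notMem_topologicallyGeneratingTuples [Nontrivial (Homeo₀ d M)] {n : ℕ}
    {f : Fin n → Homeo₀ d M} (hf : f ∈ pingPongTuples n d M) :
    f ∉ topologicallyGeneratingTuples n (Homeo₀ d M) := by
  intro hdense
  obtain ⟨V, hV, h1V, hVw⟩ := exists_isOpen_of_mem_pingPongTuples hf
  have hV1 : V = {1} := by
    refine Subset.antisymm ?_ (singleton_subset_iff.2 h1V)
    have h1 : V ⊆ closure (V ∩ Subgroup.closure (range f)) :=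
      Dense.open_subset_closure_inter hdense hV
    refine h1.trans ((closure_mono ?_).trans isClosed_singleton.closure_eq.subset)
    exact fun w hw => hVw w hw.2 hw.1
  have hconn : PreconnectedSpace (Homeo₀ d M) :=
    Subtype.preconnectedSpace isPreconnected_connectedComponent
  have huniv : ({1} : Set (Homeo₀ d M)) = univ :=
    IsClopen.eq_univ ⟨isClosed_singleton, hV1 ▸ hV⟩ (singleton_nonempty 1)
  obtain ⟨g, hg⟩ := exists_ne (1 : Homeo₀ d M)
  exact hg (huniv ▸ mem_univ g : g ∈ ({1} : Set (Homeo₀ d M)))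

/-- This keeps the perturbed tuple near `g`: multiplication is continuous, and factors with support
near `b` are near 1. -/
theorem exists_nhds_forall_mul_mul_mem (b : M) {n : ℕ} (g : Fin n → Homeo₀ d M)
    {O : Set (Fin n → Homeo₀ d M)} (hO : O ∈ 𝓝 g) :
    ∃ N ∈ 𝓝 b, ∀ h k : Fin n → Homeo₀ d M, (∀ i, h i ∈ supportedIn d N) →
      (∀ i, k i ∈ supportedIn d N) → (fun i => h i * g i * k i) ∈ O := by
  have hcont : Continuous fun p : (Fin n → Homeo₀ d M) × (Fin n → Homeo₀ d M) =>
      fun i => p.1 i * g i * p.2 i := by fun_prop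
  have h1 : (fun p : (Fin n → Homeo₀ d M) × (Fin n → Homeo₀ d M) =>
      fun i => p.1 i * g i * p.2 i) ⁻¹' O ∈ 𝓝 (1, 1) :=
    hcont.continuousAt.preimage_mem_nhds (by simpa using hO)
  obtain ⟨P, hP, Q, hQ, hPQ⟩ := mem_nhds_prod_iff.1 h1
  obtain ⟨W, hW, hWPQ⟩ : ∃ W ∈ 𝓝 (1 : Homeo₀ d M), ∀ h : Fin n → Homeo₀ d M,
      (∀ i, h i ∈ W) → h ∈ P ∩ Q := by
    have h2 := Filter.inter_mem hP hQ
    rw [nhds_pi, Filter.mem_pi'] at h2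
    obtain ⟨I, t, ht, hIt⟩ := h2
    exact ⟨⋂ i, t i, Filter.iInter_mem.2 ht, fun h hh => hIt fun i _ => mem_iInter.1 (hh i) i⟩
  obtain ⟨V, hV, hVW⟩ : ∃ V ∈ 𝓝 (1 : M ≃ₜ M), ∀ f : Homeo₀ d M, f.1.1 ∈ V → f ∈ W := by
    have h3 : IsInducing fun f : Homeo₀ d M => f.1.1 :=
      IsInducing.subtypeVal.comp IsInducing.subtypeVal
    rw [h3.nhds_eq_comap] at hW
    obtain ⟨V, hV, hVW⟩ := Filter.mem_comap.1 hW
    exact ⟨V, hV, fun f hf => hVW hf⟩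
  obtain ⟨N, hN, hNV⟩ := exists_nhds_forall_eqOn_compl_mem b hV
  refine ⟨N, hN, fun h k hh hk => hPQ (mk_mem_prod (hWPQ h fun i => hVW _ ?_).1
    (hWPQ k fun i => hVW _ ?_).2)⟩
  · exact hNV _ (hh i)
  · exact hNV _ (hk i)

theorem supportedIn_mono {D N : Set M} (h : D ⊆ N) : supportedIn d D ≤ supportedIn d N :=
  fun _ hf x hx => hf x fun hxD => hx (h hxD)

/-- The point `b` need not lie in the piece, only in the interior of its closure. Since every `g i`
fixes `b`, the piece and its preimages under the `g i` are open and dense in a common neighbourhood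
of `b`, so they have a common point. -/
theorem exists_isOpen_forall_smul_mem {e : EuclideanSpace ℝ (Fin d) → M} (he : IsOpenEmbedding e)
    {b : M} {O : Set M} (hO : IsOpen O) (hbO : b ∈ O) (hOe : O ⊆ closure (range e))
    {n : ℕ} (g : Fin n → Homeo₀ d M) (hb : ∀ i, g i • b = b) :
    ∃ G : Set (EuclideanSpace ℝ (Fin d)), IsOpen G ∧ G.Nonempty ∧
      ∀ x ∈ G, ∀ i, g i • e x ∈ range e := by
  have hcs : ∀ f : Homeo₀ d M, Continuous fun m : M => f • m := continuous_homeo₀_smul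
  refine ⟨⋂ i, (fun x => g i • e x) ⁻¹' range e, isOpen_iInter_of_finite fun i =>
    he.isOpen_range.preimage ((hcs _).comp he.continuous), ?_, fun x hx => mem_iInter.1 hx⟩
  let D : Option (Fin n) → Set M := fun o => o.elim (range e) fun i => (g i • ·) ⁻¹' range e
  obtain ⟨m, -, hm⟩ := nonempty_inter_biInter (D := D) (by
      rintro (_ | i)
      · exact he.isOpen_range
      · exact he.isOpen_range.preimage (hcs _)) Finset.univ
    (N := O ∩ ⋂ i, (g i • ·) ⁻¹' O)
    (hO.inter (isOpen_iInter_of_finite fun i => hO.preimage (hcs _)))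
    ⟨b, hbO, mem_iInter.2 fun i => by rwa [mem_preimage, hb i]⟩ (by
      rintro (_ | i)
      · exact inter_subset_left.trans hOe
      · intro x hx
        have h1 : g i • x ∈ closure (range e) := hOe (mem_iInter.1 hx.2 i)
        have h2 := (g i).1.1.preimage_closure (range e)
        exact h2.subset h1)
  simp only [Finset.mem_univ, iInter_true, mem_iInter] at hm
  obtain ⟨x, rfl⟩ := hm none
  exact ⟨x, mem_iInter.2 fun i => hm (some i)⟩

end Tuples

/-! ### Density of ping-pong tuples in dimension at least two. -/

section Density

variable {d : ℕ} [NeZero d] {M : Type*} [TopologicalSpace M] [T2Space M] [CompactSpace M]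
  [ChartedSpace (EuclideanHalfSpace d) M]

theorem nontrivial_homeo₀ (hd : 2 ≤ d) (b : M) : Nontrivial (Homeo₀ d M) := by
  obtain ⟨e, he, -⟩ := exists_isOpenEmbedding_range_subset (d := d) b Filter.univ_mem
  have : Nonempty (Fin d) := ⟨0⟩
  obtain ⟨x, y, hxy⟩ := exists_pair_ne (EuclideanSpace ℝ (Fin d))
  obtain ⟨f, -, hf, -⟩ := exists_smul_eq_of_notMem (M := M) he hd (F := ∅) finite_empty
    (x := x) (y := y) (notMem_empty _) (notMem_empty _)
  refine ⟨f, 1, ?_⟩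
  rintro rfl
  exact hxy (he.injective (by simpa using hf))

theorem dense_pingPongTuples (hd : 2 ≤ d) (hboundary : (manifoldBoundary d M).Nonempty) (n : ℕ) :
    Dense (pingPongTuples n d M) := by
  obtain ⟨b, hb⟩ := hboundary
  refine fun g => mem_closure_iff_nhds.2 fun O hO => ?_
  obtain ⟨N, hN, hNO⟩ := exists_nhds_forall_mul_mul_mem b g hO
  obtain ⟨e, he, heN, P, hP, hbP, hPe⟩ := exists_isOpenEmbedding_range_subset (d := d) b hN
  obtain ⟨G, hG, ⟨x, hx⟩, hGg⟩ := exists_isOpen_forall_smul_mem he hP hbP hPe g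
    fun i => (g i).1.2 b hb
  -- There is one centre per letter; the index `none` is the home of the base point.
  obtain ⟨a, hainj, haG⟩ := exists_injective_forall_mem (ι := Option (Fin n × Bool))
    (infinite_of_mem_nhds_euclidean hd (hG.mem_nhds hx))
  obtain ⟨δ, hδ, hδa, hδG⟩ := exists_pos_separated hainj hG haG
  choose h hh k hk hpos hneg using fun i => exists_squeeze he hd hδ hδa (g i)
    (fun s x hx => hGg x (hδG s hx) i) (some (i, true)) (some (i, false))
  refine ⟨fun i => h i * g i * k i, hNO h k (fun i => supportedIn_mono heN (hh i))
    (fun i => supportedIn_mono heN (hk i)), fun s => e '' Metric.closedBall (a s) δ,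
    fun s => e '' Metric.ball (a s) δ, fun s => (isCompact_closedBall _ _).image he.continuous,
    fun s => he.isOpenMap _ Metric.isOpen_ball, fun s => image_mono Metric.ball_subset_closedBall,
    ⟨_, _, Metric.mem_closedBall_self hδ.le, rfl⟩, fun l => ?_, ?_, ?_⟩
  · refine (disjoint_image_iff he.injective).2 (Metric.closedBall_disjoint_closedBall ?_)
    have h1 : 3 * δ ≤ dist (a none) (a (some l)) := hδa (by simp)
    linarith
  · rintro i s hs _ ⟨y, hy, rfl⟩
    exact hpos i s hs y hy
  · rintro i s hs _ ⟨y, hy, rfl⟩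
    exact hneg i s hs y hy

end Density

/-! ### Arcs issuing from a point, and interval charts. -/

section Arcs

variable {M : Type*} [TopologicalSpace M]

/-- An injective arc that starts at `b` and is open in `M` away from its end. -/
structure IsArc (b : M) (Γ : ℝ → M) (r : ℝ) : Prop where
  pos : 0 < r
  continuousOn : ContinuousOn Γ (Icc 0 r)
  injOn : InjOn Γ (Icc 0 r)
  map_zero : Γ 0 = b
  isOpen : IsOpen (Γ '' Ico 0 r)

/-- Mutually inverse homeomorphisms between an open set `V` of `M` and a set `J` of reals. -/
structure IsRealChart (κ : M → ℝ) (ψ : ℝ → M) (V : Set M) (J : Set ℝ) : Prop where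
  isOpen : IsOpen V
  continuousOn : ContinuousOn κ V
  mapsTo : MapsTo κ V J
  continuousOn_symm : ContinuousOn ψ J
  mapsTo_symm : MapsTo ψ J V
  left_inv : ∀ x ∈ V, ψ (κ x) = x
  right_inv : ∀ v ∈ J, κ (ψ v) = v

variable {κ : M → ℝ} {ψ : ℝ → M} {V : Set M} {J : Set ℝ}

theorem IsRealChart.injOn_symm (h : IsRealChart κ ψ V J) : InjOn ψ J := fun v hv w hw hvw => by
  rw [← h.right_inv v hv, hvw, h.right_inv w hw]

theorem IsRealChart.neg (h : IsRealChart κ ψ V J) :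
    IsRealChart (fun x => -κ x) (fun v => ψ (-v)) V (-J) where
  isOpen := h.isOpen
  continuousOn := h.continuousOn.neg
  mapsTo := fun x hx => by simpa using h.mapsTo hx
  continuousOn_symm := h.continuousOn_symm.comp continuousOn_neg fun v hv => hv
  mapsTo_symm := fun v hv => h.mapsTo_symm hv
  left_inv := fun x hx => by simpa using h.left_inv x hx
  right_inv := fun v hv => by simp [h.right_inv _ hv]

theorem IsRealChart.isOpen_image (h : IsRealChart κ ψ V J) {O : Set ℝ} (hO : IsOpen O) :
    IsOpen (ψ '' (O ∩ J)) := by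
  convert h.continuousOn.isOpen_inter_preimage h.isOpen hO using 1
  ext x
  constructor
  · rintro ⟨v, ⟨hvO, hvJ⟩, rfl⟩
    exact ⟨h.mapsTo_symm hvJ, by rwa [mem_preimage, h.right_inv v hvJ]⟩
  · rintro ⟨hxV, hxO⟩
    exact ⟨κ x, ⟨hxO, h.mapsTo hxV⟩, h.left_inv x hxV⟩

theorem IsRealChart.restrict (h : IsRealChart κ ψ V J) {O : Set ℝ} (hO : IsOpen O) :
    IsRealChart κ ψ (ψ '' (O ∩ J)) (O ∩ J) where
  isOpen := h.isOpen_image hO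
  continuousOn := h.continuousOn.mono (by
    rintro _ ⟨v, hv, rfl⟩
    exact h.mapsTo_symm hv.2)
  mapsTo := by
    rintro _ ⟨v, hv, rfl⟩
    rwa [h.right_inv v hv.2]
  continuousOn_symm := h.continuousOn_symm.mono inter_subset_right
  mapsTo_symm := fun v hv => ⟨v, hv, rfl⟩
  left_inv := by
    rintro _ ⟨v, hv, rfl⟩
    rw [h.right_inv v hv.2]
  right_inv := fun v hv => h.right_inv v hv.2

section T2

variable {b : M} {Γ Γ' : ℝ → M} {r r' : ℝ}

theorem IsArc.exists_isLeast (h : IsArc b Γ r) {C : Set M} (hC : IsClosed C)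
    (hne : ∃ u ∈ Icc 0 r, Γ u ∈ C) :
    ∃ t ∈ Icc 0 r, Γ t ∈ C ∧ ∀ u ∈ Icc 0 r, Γ u ∈ C → t ≤ u := by
  have h1 : IsCompact (Icc 0 r ∩ Γ ⁻¹' C) :=
    isCompact_Icc.of_isClosed_subset (h.continuousOn.preimage_isClosed_of_isClosed isClosed_Icc hC)
      inter_subset_left
  obtain ⟨t, ⟨ht, htC⟩, htl⟩ := h1.exists_isLeast hne
  exact ⟨t, ht, htC, fun u hu huC => htl ⟨hu, huC⟩⟩

variable [T2Space M]

theorem IsArc.isOpen_image_Ico (h : IsArc b Γ r) {t : ℝ} (ht0 : 0 ≤ t) (ht : t ≤ r) :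
    IsOpen (Γ '' Ico 0 t) := by
  have hK : IsClosed (Γ '' Icc t r) := (isCompact_Icc.image_of_continuousOn
    (h.continuousOn.mono (Icc_subset_Icc_left ht0))).isClosed
  convert h.isOpen.sdiff hK using 1
  ext x
  constructor
  · rintro ⟨u, hu, rfl⟩
    refine ⟨⟨u, ⟨hu.1, hu.2.trans_le ht⟩, rfl⟩, ?_⟩
    rintro ⟨v, hv, hvu⟩
    have := h.injOn ⟨ht0.trans hv.1, hv.2⟩ ⟨hu.1, hu.2.le.trans ht⟩ hvu
    exact absurd hu.2 (this ▸ hv.1.not_gt)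
  · rintro ⟨⟨u, hu, rfl⟩, hux⟩
    refine ⟨u, ⟨hu.1, ?_⟩, rfl⟩
    by_contra hut
    exact hux ⟨u, ⟨not_lt.1 hut, hu.2.le⟩, rfl⟩

theorem IsArc.isOpen_image_Ioo (h : IsArc b Γ r) {t : ℝ} (ht0 : 0 ≤ t) (ht : t ≤ r) :
    IsOpen (Γ '' Ioo t r) := by
  have hK : IsClosed (Γ '' Icc 0 t) := (isCompact_Icc.image_of_continuousOn
    (h.continuousOn.mono (Icc_subset_Icc_right ht))).isClosed
  convert h.isOpen.sdiff hK using 1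
  ext x
  constructor
  · rintro ⟨u, hu, rfl⟩
    refine ⟨⟨u, ⟨ht0.trans hu.1.le, hu.2⟩, rfl⟩, ?_⟩
    rintro ⟨v, hv, hvu⟩
    have := h.injOn ⟨hv.1, hv.2.trans ht⟩ ⟨ht0.trans hu.1.le, hu.2.le⟩ hvu
    exact absurd hu.1 (this ▸ hv.2.not_gt)
  · rintro ⟨⟨u, hu, rfl⟩, hux⟩
    refine ⟨u, ⟨?_, hu.2⟩, rfl⟩
    by_contra hut
    exact hux ⟨u, ⟨hu.1, not_lt.1 hut⟩, rfl⟩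

/-- Suppose `Γ` misses `Γ' v` and leaves the open arc `Γ'`, first at time `t`. By connectedness `Γ`
stays in `Γ' '' Ico 0 v` before `t`, so `Γ t` lies in the compact set `Γ' '' Icc 0 v`, still inside
the arc it was to leave. -/
theorem IsArc.subset_or_subset (h : IsArc b Γ r) (h' : IsArc b Γ' r') :
    Γ '' Ico 0 r ⊆ Γ' '' Ico 0 r' ∨ Γ' '' Ico 0 r' ⊆ Γ '' Ico 0 r := by
  by_contra hcon
  rw [not_or, not_subset, not_subset] at hcon
  obtain ⟨⟨_, ⟨u, hu, rfl⟩, hu'⟩, ⟨_, ⟨v, hv, rfl⟩, hv'⟩⟩ := hcon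
  obtain ⟨t, ht, htA, hlt⟩ := h.exists_isLeast h'.isOpen.isClosed_compl
    ⟨u, Ico_subset_Icc_self hu, hu'⟩
  have htr : t < r := (hlt u (Ico_subset_Icc_self hu) hu').trans_lt hu.2
  have ht0 : 0 < t := by
    refine ht.1.lt_of_ne ?_
    rintro rfl
    exact htA ⟨0, ⟨le_rfl, h'.pos⟩, by rw [h.map_zero, h'.map_zero]⟩
  have hv0 : 0 < v := by
    refine hv.1.lt_of_ne ?_
    rintro rfl
    exact hv' ⟨0, ⟨le_rfl, h.pos⟩, by rw [h.map_zero, h'.map_zero]⟩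
  have hsub : Γ '' Ico 0 t ⊆ Γ' '' Ico 0 v := by
    have hpre : IsPreconnected (Γ '' Ico 0 t) := isPreconnected_Ico.image _
      (h.continuousOn.mono (Ico_subset_Icc_self.trans (Icc_subset_Icc_right ht.2)))
    have hcov : Γ '' Ico 0 t ⊆ Γ' '' Ico 0 v ∪ Γ' '' Ioo v r' := by
      rintro _ ⟨w, hw, rfl⟩
      have hwA : Γ w ∈ Γ' '' Ico 0 r' := by
        by_contra hwA
        exact (hlt w ⟨hw.1, hw.2.le.trans ht.2⟩ hwA).not_gt hw.2
      obtain ⟨z, hz, hzw⟩ := hwA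
      rcases lt_trichotomy z v with hzv | rfl | hzv
      · exact Or.inl ⟨z, ⟨hz.1, hzv⟩, hzw⟩
      · exact absurd ⟨w, ⟨hw.1, hw.2.trans htr⟩, hzw.symm⟩ hv'
      · exact Or.inr ⟨z, ⟨hzv, hz.2⟩, hzw⟩
    refine hpre.subset_left_of_subset_union (h'.isOpen_image_Ico hv.1 hv.2.le)
      (h'.isOpen_image_Ioo hv.1 hv.2.le) ?_ hcov ⟨b, ⟨0, ⟨le_rfl, ht0⟩, h.map_zero⟩,
        ⟨0, ⟨le_rfl, hv0⟩, h'.map_zero⟩⟩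
    rw [disjoint_left]
    rintro _ ⟨z, hz, rfl⟩ ⟨w, hw, hwz⟩
    have := h'.injOn ⟨hv.1.trans hw.1.le, hw.2.le⟩ ⟨hz.1, hz.2.le.trans hv.2.le⟩ hwz
    exact absurd hz.2 (this ▸ hw.1.not_gt)
  have hcl : Γ t ∈ closure (Γ '' Ico 0 t) := by
    have h1 : closure (Ico 0 t) = Icc 0 t := closure_Ico ht0.ne
    exact (h.continuousOn.mono (h1.subset.trans (Icc_subset_Icc_right ht.2))).image_closure
      (mem_image_of_mem Γ (h1.symm.subset ⟨ht0.le, le_rfl⟩))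
  have hcl2 : Γ t ∈ Γ' '' Icc 0 v := by
    have hK : IsClosed (Γ' '' Icc 0 v) := (isCompact_Icc.image_of_continuousOn
      (h'.continuousOn.mono (Icc_subset_Icc_right hv.2.le))).isClosed
    exact closure_minimal (hsub.trans (image_mono Ico_subset_Icc_self)) hK hcl
  exact htA (image_mono (Icc_subset_Ico_right hv.2) hcl2)

/-- Following an arc until it enters a chart interval, and then following the interval. -/
theorem IsArc.exists_extend (h : IsArc b Γ r) (hψ : IsRealChart κ ψ V J) {p η c : ℝ}
    (hJ : Ioc p c ⊆ J) (hηc : η ≤ c)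
    (hb : b ∉ ψ '' Ioo p c) (hdisj : ∀ u ∈ Icc 0 r, Γ u ∉ ψ '' Icc η c)
    (hmeet : ∃ u ∈ Ico 0 r, Γ u ∈ ψ '' Ioo p η) :
    ∃ Θ R, IsArc b Θ R ∧ Θ R = ψ c ∧ ∃ l ∈ Ioo p η, ψ '' Ioc l c ⊆ Θ '' Icc 0 R := by
  obtain ⟨t₀, ht₀, s₀, hs₀, hst₀⟩ := hmeet
  have hopen : IsOpen (ψ '' Ioo p c) := by
    convert hψ.isOpen_image (isOpen_Ioo (a := p) (b := c)) using 2
    exact (inter_eq_left.2 (Ioo_subset_Ioc_self.trans hJ)).symm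
  have hs₀c : Icc s₀ c ⊆ Ioc p c := fun v hv => ⟨hs₀.1.trans_le hv.1, hv.2⟩
  have hC : IsClosed (ψ '' Icc s₀ c) := (isCompact_Icc.image_of_continuousOn
    (hψ.continuousOn_symm.mono (hs₀c.trans hJ))).isClosed
  -- The arc is cut at its first entry into the chart segment from `s₀` to `c`; from there the new
  -- arc follows the chart, which the old arc has not yet met beyond `s`.
  obtain ⟨t, ht, ⟨s, hs, hst⟩, hlt⟩ := h.exists_isLeast hC
    ⟨t₀, Ico_subset_Icc_self ht₀, s₀, ⟨le_rfl, hs₀.2.le.trans hηc⟩, hst₀⟩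
  have hsη : s < η := by
    by_contra hsη
    exact hdisj t ht ⟨s, ⟨not_lt.1 hsη, hs.2⟩, hst⟩
  have hsp : s ∈ Ioo p c := ⟨hs₀.1.trans_le hs.1, hsη.trans_le hηc⟩
  have ht0 : 0 < t := by
    refine ht.1.lt_of_ne ?_
    rintro rfl
    exact hb ⟨s, hsp, hst.trans h.map_zero⟩
  obtain ⟨u₁, hu₁, hu₁W⟩ : ∃ u₁ ∈ Ico 0 t, ∀ u ∈ Icc u₁ t, Γ u ∈ ψ '' Ioo p c := by
    have h1 : Γ ⁻¹' (ψ '' Ioo p c) ∈ 𝓝[Icc 0 t] t :=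
      ((h.continuousOn.mono (Icc_subset_Icc_right ht.2)) t ⟨ht0.le, le_rfl⟩)
        (hopen.mem_nhds ⟨s, hsp, hst⟩)
    rw [nhdsWithin_Icc_eq_nhdsLE ht0, mem_nhdsLE_iff_exists_mem_Ico_Ioc_subset ht0] at h1
    obtain ⟨u₁, hu₁, hW⟩ := h1
    exact ⟨(u₁ + t) / 2, ⟨by linarith [hu₁.1], by linarith [hu₁.2]⟩,
      fun u hu => hW ⟨by linarith [hu₁.2, hu.1], hu.2⟩⟩
  have hκc : ContinuousOn (fun u => κ (Γ u)) (Icc u₁ t) :=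
    hψ.continuousOn.comp (h.continuousOn.mono (Icc_subset_Icc hu₁.1 ht.2)) fun u hu => by
      obtain ⟨v, hv, hvu⟩ := hu₁W u hu
      exact hvu ▸ hψ.mapsTo_symm (hJ (Ioo_subset_Ioc_self hv))
  obtain ⟨l, hl, hlu⟩ := hu₁W u₁ ⟨le_rfl, hu₁.2.le⟩
  have hls : l < s := by
    by_contra hls
    have := hlt u₁ ⟨hu₁.1, hu₁.2.le.trans ht.2⟩ ⟨l, ⟨hs.1.trans (not_lt.1 hls), hl.2.le⟩, hlu⟩
    exact this.not_gt hu₁.2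
  -- By the intermediate value theorem the arc runs over the whole chart segment from `l` to `s`
  -- just before the junction. Hence the image of the new arc is open there as well.
  have hback : ∀ v ∈ Icc l s, ∃ u ∈ Icc u₁ t, Γ u = ψ v := by
    intro v hv
    have h1 := intermediate_value_Icc hu₁.2.le hκc
    rw [← hlu, ← hst, hψ.right_inv l (hJ (Ioo_subset_Ioc_self hl)),
      hψ.right_inv s (hJ (Ioo_subset_Ioc_self hsp))] at h1
    obtain ⟨u, hu, huv⟩ := h1 hv
    obtain ⟨w, hw, hwu⟩ := hu₁W u hu
    refine ⟨u, hu, ?_⟩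
    simp only [← hwu, hψ.right_inv w (hJ (Ioo_subset_Ioc_self hw))] at huv
    rw [← hwu, huv]
  have hsc := hsp.2
  let Θ : ℝ → M := fun u => if u ≤ t then Γ u else ψ (s + (u - t))
  have hΘ1 : ∀ u ≤ t, Θ u = Γ u := fun u hu => if_pos hu
  have hΘ2 : ∀ u, t ≤ u → Θ u = ψ (s + (u - t)) := fun u hu => by
    rcases hu.eq_or_lt with rfl | hu
    · rw [hΘ1 _ le_rfl, sub_self, add_zero, hst]
    · exact if_neg hu.not_ge
  have hR : t < t + (c - s) := by linarith
  refine ⟨Θ, t + (c - s), ⟨ht0.trans hR, ?_, ?_, ?_, ?_⟩, ?_, l, ⟨hl.1, hls.trans hsη⟩, ?_⟩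
  · rw [← Icc_union_Icc_eq_Icc ht0.le hR.le]
    refine ContinuousOn.union_of_isClosed ?_ ?_ isClosed_Icc isClosed_Icc
    · exact (h.continuousOn.mono (Icc_subset_Icc_right ht.2)).congr fun u hu => hΘ1 u hu.2
    · refine ContinuousOn.congr (f := fun u => ψ (s + (u - t))) ?_ fun u hu => hΘ2 u hu.1
      refine hψ.continuousOn_symm.comp (by fun_prop) fun u hu => hJ ⟨?_, ?_⟩
      · linarith [hsp.1, hu.1]
      · linarith [hu.2]
  · have hcross : ∀ u w, u ∈ Icc 0 t → w ∈ Ioc t (t + (c - s)) → Θ u ≠ Θ w := by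
      intro u w hu hw huw
      rw [hΘ1 u hu.2, hΘ2 w hw.1.le] at huw
      have h1 : s + (w - t) ∈ Icc s₀ c := ⟨by linarith [hs.1, hw.1], by linarith [hw.2]⟩
      have h2 : t = u := le_antisymm (hlt u ⟨hu.1, hu.2.trans ht.2⟩ ⟨_, h1, huw.symm⟩) hu.2
      rw [← h2, ← hst] at huw
      have := hψ.injOn_symm (hJ (Ioo_subset_Ioc_self hsp)) (hJ (hs₀c h1)) huw
      linarith [hw.1]
    intro u hu w hw huw
    rcases le_or_gt u t with hut | hut <;> rcases le_or_gt w t with hwt | hwt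
    · rw [hΘ1 u hut, hΘ1 w hwt] at huw
      exact h.injOn ⟨hu.1, hut.trans ht.2⟩ ⟨hw.1, hwt.trans ht.2⟩ huw
    · exact absurd huw (hcross u w ⟨hu.1, hut⟩ ⟨hwt, hw.2⟩)
    · exact absurd huw.symm (hcross w u ⟨hw.1, hwt⟩ ⟨hut, hu.2⟩)
    · rw [hΘ2 u hut.le, hΘ2 w hwt.le] at huw
      have := hψ.injOn_symm (hJ ⟨by linarith [hsp.1], by linarith [hu.2]⟩)
        (hJ ⟨by linarith [hsp.1], by linarith [hw.2]⟩) huw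
      linarith
  · rw [hΘ1 0 ht0.le, h.map_zero]
  · have h1 : Θ '' Ico 0 (t + (c - s)) = Γ '' Ico 0 t ∪ ψ '' Ioo l c := by
      ext x
      constructor
      · rintro ⟨u, hu, rfl⟩
        rcases lt_or_ge u t with hut | hut
        · exact Or.inl ⟨u, ⟨hu.1, hut⟩, (hΘ1 u hut.le).symm⟩
        · exact Or.inr ⟨_, ⟨by linarith, by linarith [hu.2]⟩, (hΘ2 u hut).symm⟩
      · rintro (⟨u, hu, rfl⟩ | ⟨v, hv, rfl⟩)
        · exact ⟨u, ⟨hu.1, hu.2.trans hR⟩, hΘ1 u hu.2.le⟩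
        · rcases le_or_gt v s with hvs | hvs
          · obtain ⟨u, hu, huv⟩ := hback v ⟨hv.1.le, hvs⟩
            exact ⟨u, ⟨hu₁.1.trans hu.1, hu.2.trans_lt hR⟩, by rw [hΘ1 u hu.2, huv]⟩
          · refine ⟨t + (v - s), ⟨by linarith, by linarith [hv.2]⟩, ?_⟩
            rw [hΘ2 _ (by linarith)]
            congr 1
            ring
    rw [h1]
    refine (h.isOpen_image_Ico ht0.le ht.2).union ?_
    convert hψ.isOpen_image (isOpen_Ioo (a := l) (b := c)) using 2
    exact (inter_eq_left.2 fun v hv => hJ ⟨hl.1.trans hv.1, hv.2.le⟩).symm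
  · rw [hΘ2 _ hR.le]
    congr 1
    ring
  · rintro _ ⟨v, hv, rfl⟩
    rcases le_or_gt v s with hvs | hvs
    · obtain ⟨u, hu, huv⟩ := hback v ⟨hv.1.le, hvs⟩
      exact ⟨u, ⟨hu₁.1.trans hu.1, hu.2.trans hR.le⟩, by rw [hΘ1 u hu.2, huv]⟩
    · refine ⟨t + (v - s), ⟨by linarith, by linarith [hv.2]⟩, ?_⟩
      rw [hΘ2 _ (by linarith)]
      congr 1
      ring

theorem IsArc.restrict (h : IsArc b Γ r) {t : ℝ} (ht0 : 0 < t) (ht : t ≤ r) : IsArc b Γ t where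
  pos := ht0
  continuousOn := h.continuousOn.mono (Icc_subset_Icc_right ht)
  injOn := h.injOn.mono (Icc_subset_Icc_right ht)
  map_zero := h.map_zero
  isOpen := h.isOpen_image_Ico ht0.le ht

/-- An arc that enters a chart interval around `y` extends to an arc through `y`. -/
theorem IsArc.exists_mem_of_meet (h : IsArc b Γ r) {p q : ℝ} (hψ : IsRealChart κ ψ V (Ioo p q))
    (hb : b ∉ ψ '' Ioo p q) {y : M} (hy : y ∈ V) (hyΓ : y ∉ Γ '' Icc 0 r)
    (hmeet : ∃ u ∈ Ico 0 r, Γ u ∈ V ∧ κ (Γ u) < κ y) :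
    ∃ Θ R, IsArc b Θ R ∧ y ∈ Θ '' Ico 0 R := by
  have hη := hψ.mapsTo hy
  have hK : IsClosed (Γ '' Icc 0 r) := (isCompact_Icc.image_of_continuousOn h.continuousOn).isClosed
  have h1 : ψ ⁻¹' (Γ '' Icc 0 r)ᶜ ∈ 𝓝 (κ y) :=
    (hψ.continuousOn_symm.continuousAt (Ioo_mem_nhds hη.1 hη.2)).preimage_mem_nhds
      (hK.isOpen_compl.mem_nhds (by rwa [hψ.left_inv y hy]))
  -- The old arc misses the chart segment from `κ y` up to `c`. The extension ends at the midpoint: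
  -- beyond `y`, and with a closed segment that is still missed.
  obtain ⟨c, hc, hcK⟩ := (mem_nhdsGE_iff_exists_mem_Ioc_Ico_subset hη.2).1
    (nhdsWithin_le_nhds h1 : _ ∈ 𝓝[≥] κ y)
  have hc1 := hc.1
  have hJ : Ioc p ((κ y + c) / 2) ⊆ Ioo p q := fun v hv => ⟨hv.1, by linarith [hv.2, hc.2, hc.1]⟩
  obtain ⟨u, hu, huV, huy⟩ := hmeet
  obtain ⟨Θ, R, hΘ, hΘR, l, hl, hlΘ⟩ := h.exists_extend hψ (c := (κ y + c) / 2) hJ (by linarith)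
    (fun hb' => hb (image_mono (Ioo_subset_Ioc_self.trans hJ) hb'))
    (by
      rintro w hw ⟨v, hv, hvw⟩
      exact hcK (show v ∈ Ico (κ y) c from ⟨hv.1, by linarith [hv.2]⟩) ⟨w, hw, hvw.symm⟩)
    ⟨u, hu, κ (Γ u), ⟨(hψ.mapsTo huV).1, huy⟩, hψ.left_inv _ huV⟩
  refine ⟨Θ, R, hΘ, ?_⟩
  obtain ⟨w, hw, hwy⟩ := hlΘ ⟨κ y, ⟨hl.2, by linarith⟩, rfl⟩
  rw [hψ.left_inv y hy] at hwy
  refine ⟨w, ⟨hw.1, hw.2.lt_of_ne ?_⟩, hwy⟩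
  rintro rfl
  have hψc : ψ (κ y) = ψ ((κ y + c) / 2) :=
    (hψ.left_inv y hy).trans (hwy.symm.trans hΘR)
  have := hψ.injOn_symm hη (hJ ⟨by linarith [hη.1], le_rfl⟩) hψc
  linarith

/-- An arc that is open in `M`, its end included, is a connected component. -/
theorem IsArc.nonempty_homeomorph (h : IsArc b Γ r) (hopen : IsOpen (Γ '' Icc 0 r)) :
    Nonempty (connectedComponent b ≃ₜ Icc (0 : ℝ) 1) := by
  have hclosed : IsClosed (Γ '' Icc 0 r) :=
    (isCompact_Icc.image_of_continuousOn h.continuousOn).isClosed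
  have hbK : b ∈ Γ '' Icc 0 r := ⟨0, ⟨le_rfl, h.pos.le⟩, h.map_zero⟩
  have hK : connectedComponent b = Γ '' Icc 0 r :=
    Subset.antisymm (IsClopen.connectedComponent_subset ⟨hclosed, hopen⟩ hbK)
      ((isPreconnected_Icc.image _ h.continuousOn).subset_connectedComponent hbK)
  have hbij : BijOn Γ (Icc 0 r) (connectedComponent b) :=
    ⟨fun u hu => hK ▸ ⟨u, hu, rfl⟩, h.injOn, hK.subset⟩
  have hcont : Continuous (hbij.equiv Γ) :=
    (continuousOn_iff_continuous_domRestrict.1 h.continuousOn).subtype_mk _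
  exact ⟨(hcont.homeoOfEquivCompactToT2).symm.trans (iccHomeoI 0 r h.pos)⟩

end T2

end Arcs

/-! ### Boundary components of compact one-manifolds. -/

section OneManifold

variable {M : Type*} [TopologicalSpace M]

/-- The point of the one-dimensional half-space with coordinate `-v`, for `v ≤ 0`. -/
noncomputable def halfLine (v : ℝ) : EuclideanHalfSpace 1 :=
  ⟨(max 0 (-v)) • EuclideanSpace.single 0 1, by simp⟩

theorem continuous_halfLine : Continuous halfLine :=
  Continuous.subtype_mk (by fun_prop) _

theorem halfLine_coord {v : ℝ} (hv : v ≤ 0) : (halfLine v).1 0 = -v := by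
  simp [halfLine, hv]

theorem halfLine_neg_coord (x : EuclideanHalfSpace 1) : halfLine (-x.1 0) = x := by
  refine Subtype.ext (PiLp.ext fun i => ?_)
  have := x.2
  rw [Subsingleton.elim i 0, halfLine_coord (by linarith), neg_neg]

theorem dist_halfLine (x : EuclideanHalfSpace 1) {v : ℝ} (hv : v ≤ 0) :
    dist (halfLine v).1 x.1 = |v + x.1 0| := by
  rw [EuclideanSpace.dist_eq]
  simp only [Fin.sum_univ_one, Fin.isValue, halfLine_coord hv]
  rw [Real.sqrt_sq dist_nonneg, Real.dist_eq, ← abs_neg]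
  congr 1
  ring

/-- The sign makes a point on the face of the half-line the right end of its chart interval, so that
an arc reaches it with increasing coordinate. -/
theorem isRealChart_halfLine (φ : OpenPartialHomeomorph M (EuclideanHalfSpace 1)) :
    IsRealChart (fun m => -(φ m).1 0) (fun v => φ.symm (halfLine v)) φ.source
      {v | v ≤ 0 ∧ halfLine v ∈ φ.target} where
  isOpen := φ.open_source
  continuousOn := by
    have h1 : Continuous fun x : EuclideanHalfSpace 1 => -x.1 0 := by
      have := continuous_val_halfSpace (d := 1)
      fun_prop
    exact h1.comp_continuousOn φ.continuousOn
  mapsTo := fun m hm => ⟨by have := (φ m).2; linarith, by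
    rw [halfLine_neg_coord]; exact φ.map_source hm⟩
  continuousOn_symm := φ.symm.continuousOn.comp continuous_halfLine.continuousOn fun v hv => hv.2
  mapsTo_symm := fun v hv => φ.map_target hv.2
  left_inv := fun m hm => by rw [halfLine_neg_coord, φ.left_inv hm]
  right_inv := fun v hv => by rw [φ.right_inv hv.2, halfLine_coord hv.1, neg_neg]

variable [ChartedSpace (EuclideanHalfSpace 1) M]

/-- Every point of a `1`-manifold has an interval chart. -/
theorem exists_isRealChart (y : M) : ∃ (κ : M → ℝ) (ψ : ℝ → M) (V : Set M) (J : Set ℝ) (p q : ℝ),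
    IsRealChart κ ψ V J ∧ y ∈ V ∧ p < κ y ∧ (J = Ioo p q ∧ κ y < q ∨ J = Ioc p q ∧ κ y = q) ∧
      ψ '' Ioo p q ⊆ manifoldInterior 1 M := by
  let φ := chartAt (EuclideanHalfSpace 1) y
  have hy : y ∈ φ.source := mem_chart_source _ y
  obtain ⟨r, hr, hrt⟩ := exists_forall_dist_lt_symm_mem φ hy Filter.univ_mem
  have hφ := isRealChart_halfLine φ
  have h0 : 0 ≤ (φ y).1 0 := (φ y).2
  have hrt' : ∀ v ≤ 0, |v + (φ y).1 0| < r → halfLine v ∈ φ.target := fun v hv hvr =>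
    (hrt _ (by rwa [dist_halfLine _ hv])).1
  have hyφ : halfLine (-(φ y).1 0) ∈ φ.target := hrt' _ (by linarith) (by simpa using hr)
  have hint : ∀ v < 0, halfLine v ∈ φ.target → φ.symm (halfLine v) ∈ manifoldInterior 1 M :=
    fun v hv hvt => mem_manifoldInterior_of_pos φ (φ.map_target hvt) (by
      rw [φ.right_inv hvt, halfLine_coord hv.le]
      linarith)
  have hyim : ∀ O : Set ℝ, -(φ y).1 0 ∈ O → y ∈ (fun v => φ.symm (halfLine v)) ''
      (O ∩ {v | v ≤ 0 ∧ halfLine v ∈ φ.target}) := fun O hO =>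
    ⟨_, ⟨hO, by linarith, hyφ⟩, hφ.left_inv y hy⟩
  rcases h0.eq_or_lt with h0 | h0
  · refine ⟨_, _, _, _, -r, 0, hφ.restrict (isOpen_Ioo (a := -r) (b := r)), hyim _ ?_, ?_,
      Or.inr ⟨?_, ?_⟩, ?_⟩
    · simp [← h0, hr]
    · simp [← h0, hr]
    · ext v
      constructor
      · exact fun hv => ⟨hv.1.1, hv.2.1⟩
      · refine fun hv => ⟨⟨hv.1, hv.2.trans_lt hr⟩, hv.2, hrt' v hv.2 ?_⟩
        rw [← h0, add_zero, abs_lt]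
        exact ⟨hv.1, hv.2.trans_lt hr⟩
    · simp [← h0]
    · rintro _ ⟨v, hv, rfl⟩
      refine hint v hv.2 (hrt' v hv.2.le ?_)
      rw [← h0, add_zero, abs_lt]
      exact ⟨hv.1, hv.2.trans hr⟩
  -- The radius is bounded by the coordinate of `y` so that the interval stays off the face.
  · have hm : 0 < min r ((φ y).1 0) := lt_min hr h0
    have hmr := min_le_left r ((φ y).1 0)
    have hmy := min_le_right r ((φ y).1 0)
    generalize min r ((φ y).1 0) = m at hm hmr hmy
    have hv0 : ∀ v ∈ Ioo (-(φ y).1 0 - m) (-(φ y).1 0 + m), v < 0 ∧ halfLine v ∈ φ.target := by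
      intro v hv
      have : v < 0 := by linarith [hv.2]
      refine ⟨this, hrt' v this.le ?_⟩
      rw [abs_lt]
      constructor <;> linarith [hv.1, hv.2]
    refine ⟨_, _, _, _, -(φ y).1 0 - m, -(φ y).1 0 + m, 
      hφ.restrict (isOpen_Ioo (a := -(φ y).1 0 - m) (b := -(φ y).1 0 + m)), hyim _ ?_, ?_,
      Or.inl ⟨?_, ?_⟩, ?_⟩
    · constructor <;> linarith
    · linarith
    · exact inter_eq_left.2 fun v hv => ⟨(hv0 v hv).1.le, (hv0 v hv).2⟩
    · linarith
    · rintro _ ⟨v, hv, rfl⟩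
      exact hint v (hv0 v hv).1 (hv0 v hv).2

theorem exists_isArc {b : M} (hb : b ∈ manifoldBoundary 1 M) : ∃ Γ r, IsArc b Γ r := by
  obtain ⟨κ, ψ, V, J, p, q, hψ, hbV, hp, ⟨rfl, hq⟩ | ⟨rfl, rfl⟩, hint⟩ := exists_isRealChart b
  · exact absurd (hint ⟨κ b, ⟨hp, hq⟩, hψ.left_inv b hbV⟩) hb
  · have hJ : ∀ u ∈ Icc 0 ((κ b - p) / 2), κ b - u ∈ Ioc p (κ b) := fun u hu =>
      ⟨by linarith [hu.2], by linarith [hu.1]⟩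
    refine ⟨fun u => ψ (κ b - u), (κ b - p) / 2, by linarith, ?_, ?_, ?_, ?_⟩
    · exact hψ.continuousOn_symm.comp (by fun_prop) hJ
    · intro u hu v hv huv
      have := hψ.injOn_symm (hJ u hu) (hJ v hv) huv
      linarith
    · simpa using hψ.left_inv b hbV
    · convert hψ.isOpen_image (isOpen_Ioi (a := κ b - (κ b - p) / 2)) using 1
      ext x
      constructor
      · rintro ⟨u, hu, rfl⟩
        exact ⟨_, ⟨by rw [mem_Ioi]; linarith [hu.2], hJ u (Ico_subset_Icc_self hu)⟩, rfl⟩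
      · rintro ⟨v, ⟨hv, hvJ⟩, rfl⟩
        rw [mem_Ioi] at hv
        exact ⟨κ b - v, ⟨by linarith [hvJ.2], by linarith⟩, by simp⟩

variable [T2Space M] [CompactSpace M]

/-- If the union were closed it would be compact, and, the arcs being nested, a single half-open arc
would fill it. But the end of that arc is a limit point which injectivity keeps out. -/
theorem not_isClosed_iUnion_arcs {b : M} (hb : b ∈ manifoldBoundary 1 M) :
    ¬ IsClosed (⋃ P : {P : (ℝ → M) × ℝ // IsArc b P.1 P.2}, P.1.1 '' Ico 0 P.1.2) := by
  intro hclosed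
  obtain ⟨Γ₀, r₀, h₀⟩ := exists_isArc hb
  have : Nonempty {P : (ℝ → M) × ℝ // IsArc b P.1 P.2} := ⟨⟨⟨Γ₀, r₀⟩, h₀⟩⟩
  obtain ⟨⟨⟨Γ, r⟩, h⟩, hP⟩ := hclosed.isCompact.elim_directed_cover _ (fun P => P.2.isOpen)
    Subset.rfl (fun P Q => by
      rcases P.2.subset_or_subset Q.2 with hPQ | hPQ
      · exact ⟨Q, hPQ, Subset.rfl⟩
      · exact ⟨P, Subset.rfl, hPQ⟩)
  have hr := h.pos
  have hcl : Γ r ∈ closure (Γ '' Ico 0 r) := by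
    have h1 : closure (Ico 0 r) = Icc 0 r := closure_Ico hr.ne
    exact (h.continuousOn.mono h1.subset).image_closure
      (mem_image_of_mem Γ (h1.symm.subset ⟨hr.le, le_rfl⟩))
  have hmem := closure_minimal (subset_iUnion
    (fun P : {P : (ℝ → M) × ℝ // IsArc b P.1 P.2} => P.1.1 '' Ico 0 P.1.2) ⟨⟨Γ, r⟩, h⟩) hclosed hcl
  obtain ⟨u, hu, hur⟩ := hP hmem
  have := h.injOn (Ico_subset_Icc_self hu) ⟨hr.le, le_rfl⟩ hur
  exact hu.2.ne this

/-- The connected component of a boundary point of a compact `1`-manifold is an interval. -/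
theorem nonempty_connectedComponent_homeomorph {b : M} (hb : b ∈ manifoldBoundary 1 M) :
    Nonempty (connectedComponent b ≃ₜ Icc (0 : ℝ) 1) := by
  have hnot := not_isClosed_iUnion_arcs hb
  rw [← closure_subset_iff_isClosed, not_subset] at hnot
  obtain ⟨y, hycl, hyT⟩ := hnot
  have hyT' : ∀ Γ r, IsArc b Γ r → y ∉ Γ '' Ico 0 r := fun Γ r h hy =>
    hyT (mem_iUnion.2 ⟨⟨⟨Γ, r⟩, h⟩, hy⟩)
  obtain ⟨κ, ψ, V, J, p, q, hψ, hyV, hp, hJ, hint⟩ := exists_isRealChart y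
  obtain ⟨x, hxV, hxT⟩ := mem_closure_iff.1 hycl V hψ.isOpen hyV
  obtain ⟨⟨⟨Γ, r'⟩, h'⟩, u, hu, rfl⟩ := mem_iUnion.1 hxT
  replace h' : IsArc b Γ r' := h'
  replace hu : u ∈ Ico 0 r' := hu
  replace hxV : Γ u ∈ V := hxV
  -- Shortening the arc makes `y` avoid its closed image, end included.
  obtain ⟨r, hur, hrr⟩ := exists_between hu.2
  have h := h'.restrict (hu.1.trans_lt hur) hrr.le
  have hyΓ : y ∉ Γ '' Icc 0 r := fun hy =>
    hyT' Γ r' h' (image_mono (Icc_subset_Ico_right hrr) hy)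
  have hbψ : b ∉ ψ '' Ioo p q := fun hbψ => hb (hint hbψ)
  have hne : κ (Γ u) ≠ κ y := fun hκ => hyΓ ⟨u, ⟨hu.1, hur.le⟩, by
    rw [← hψ.left_inv _ hxV, hκ, hψ.left_inv y hyV]⟩
  rcases hJ with ⟨rfl, hq⟩ | ⟨rfl, rfl⟩
  · exfalso
    rcases hne.lt_or_gt with hlt | hgt
    · obtain ⟨Θ, R, hΘ, hyΘ⟩ := h.exists_mem_of_meet hψ hbψ hyV hyΓ ⟨u, ⟨hu.1, hur⟩, hxV, hlt⟩
      exact hyT' Θ R hΘ hyΘ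
    -- The arc entered on the far side of `y`; reversing the chart brings this back to the previous
    -- case.
    · have hψ' := hψ.neg
      have hneg : -Ioo p q = Ioo (-q) (-p) := by
        ext v
        simp only [mem_neg, mem_Ioo]
        constructor <;> rintro ⟨h1, h2⟩ <;> constructor <;> linarith
      rw [hneg] at hψ'
      obtain ⟨Θ, R, hΘ, hyΘ⟩ := h.exists_mem_of_meet hψ' (by
          rintro ⟨v, hv, hvb⟩
          exact hbψ ⟨-v, ⟨by linarith [hv.2], by linarith [hv.1]⟩, hvb⟩) hyV hyΓ
        ⟨u, ⟨hu.1, hur⟩, hxV, neg_lt_neg hgt⟩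
      exact hyT' Θ R hΘ hyΘ
  · have hlt : κ (Γ u) < κ y := lt_of_le_of_ne (hψ.mapsTo hxV).2 hne
    obtain ⟨Θ, R, hΘ, hΘR, l, hl, hlΘ⟩ := h.exists_extend hψ Subset.rfl le_rfl hbψ (by
        rintro w hw ⟨v, hv, hvw⟩
        rw [Icc_self, mem_singleton_iff] at hv
        rw [hv, hψ.left_inv y hyV] at hvw
        exact hyΓ ⟨w, hw, hvw.symm⟩)
      ⟨u, ⟨hu.1, hur⟩, κ (Γ u), ⟨(hψ.mapsTo hxV).1, hlt⟩, hψ.left_inv _ hxV⟩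
    -- Here `y` is the right end of the chart, so the half-open segment ending at `y` is open in `M`
    -- and the arc is open with its end included.
    refine hΘ.nonempty_homeomorph ?_
    have hK : Θ '' Icc 0 R = Θ '' Ico 0 R ∪ ψ '' (Ioi l ∩ Ioc p (κ y)) := by
      refine Subset.antisymm ?_ (union_subset (image_mono Ico_subset_Icc_self) ?_)
      · rintro _ ⟨w, hw, rfl⟩
        rcases hw.2.lt_or_eq with hwR | rfl
        · exact Or.inl ⟨w, ⟨hw.1, hwR⟩, rfl⟩
        · exact Or.inr ⟨κ y, ⟨hl.2, hp, le_rfl⟩, hΘR.symm⟩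
      · exact (image_mono (show Ioi l ∩ Ioc p (κ y) ⊆ Ioc l (κ y) from
          fun v hv => ⟨hv.1, hv.2.2⟩)).trans hlΘ
    rw [hK]
    exact hΘ.isOpen.union (hψ.isOpen_image isOpen_Ioi)

end OneManifold

end ManifoldHomeo

theorem mainTheorem6 (d : ℕ) [NeZero d] (M : Type*) [TopologicalSpace M] [T2Space M]
    [CompactSpace M] [ChartedSpace (EuclideanHalfSpace d) M]
    (hboundary : (ManifoldHomeo.manifoldBoundary d M).Nonempty)
    (hinterval : ∀ x : M, IsEmpty (connectedComponent x ≃ₜ Icc (0 : ℝ) 1)) (n : ℕ) :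
    (∃ U : Set (Fin n → ManifoldHomeo.Homeo₀ d M), IsOpen U ∧ Dense U ∧
      U ⊆ ManifoldHomeo.discreteTuples n (ManifoldHomeo.Homeo₀ d M)) ∧
    (∃ C : Set (Fin n → ManifoldHomeo.Homeo₀ d M), IsClosed C ∧ IsNowhereDense C ∧
      ManifoldHomeo.topologicallyGeneratingTuples n (ManifoldHomeo.Homeo₀ d M) ⊆ C) := by
  obtain ⟨b, hb⟩ := hboundary
  have hd : 2 ≤ d := by
    have h0 : d ≠ 0 := NeZero.ne d
    by_contra hd
    obtain rfl : d = 1 := by omega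
    exact not_nonempty_iff.2 (hinterval b) (ManifoldHomeo.nonempty_connectedComponent_homeomorph hb)
  have hopen := ManifoldHomeo.isOpen_pingPongTuples (d := d) (M := M) n
  have hdense := ManifoldHomeo.dense_pingPongTuples (M := M) hd ⟨b, hb⟩ n
  have := ManifoldHomeo.nontrivial_homeo₀ hd b
  refine ⟨⟨_, hopen, hdense, ManifoldHomeo.pingPongTuples_subset_discreteTuples n⟩,
    (ManifoldHomeo.pingPongTuples n d M)ᶜ, ?_⟩
  have h1 := isClosed_isNowhereDense_iff_compl.2 (by rw [compl_compl]; exact ⟨hopen, hdense⟩ :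
    IsOpen (ManifoldHomeo.pingPongTuples n d M)ᶜᶜ ∧ Dense (ManifoldHomeo.pingPongTuples n d M)ᶜᶜ)
  exact ⟨h1.1, h1.2, fun f hf hfU => ManifoldHomeo.notMem_topologicallyGeneratingTuples hfU hf⟩
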